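/- Let $\rho$ be one of the following two probability densities on $\mathbb{R}^n$, and let $\mathcal{X}=\{x:\rho(x)>0\}$ and $P_X=\rho\,dx$: (i) the density of the uniform distribution on a nonempty, open, bounded, convex set $\mathcal{X}\subset\mathbb{R}^n$; (ii) the density of the standard normal distribution $\mathcal{N}(0,I)$, so that $\mathcal{X}=\mathbb{R}^n$. Then there is a constant $C>0$, depending only on $\rho$, such that the following holds. Let $f:\mathcal{X}\to\mathbb{R}$ be measurable, with partial derivatives that exist at every point of $\mathcal{X}$ and are square integrable with respect to $P_X$. Let $$\int_{\mathcal{X}}\nabla f(x)\,\nabla f(x)^\top\rho(x)\,dx=W\Lambda W^\top,\qquad \Lambda=\operatorname{diag}(\lambda_1,\dots,\lambda_n),\quad \lambda_1\ge\dots\ge\lambda_n,$$ with $W\in\mathbb{R}^{n\times n}$ orthogonal. Let $1\le k\le n-1$, $\varepsilon>0$, and let $\hat W=[\hat W_1\;\hat W_2]\in\mathbb{R}^{n\times n}$ be an orthogonal matrix with $\|W-\hat W\|\le\varepsilon$ in the spectral norm, where $\hat W_1$ consists of the first $k$ columns of $\hat W$ and $\hat W_2$ of the others. For $\hat y\in\hat{\mathcal{Y}}:=\hat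 W_1^\top\mathcal{X}$ let $P^{\hat y}$ be the distribution on $\mathbb{R}^{n-k}$ with density $$\rho_{\hat Z|\hat Y}(\hat z\,|\,\hat y)=\frac{\rho(\hat W_1\hat y+\hat W_2\hat z)}{\int_{\mathbb{R}^{n-k}}\rho(\hat W_1\hat y+\hat W_2 z')\,dz'}.$$ Let $N\ge1$, and let $\hat Z^{\hat y}_j$ ($j=1,\dots,N$, $\hat y\in\hat{\mathcal{Y}}$) be random vectors on a probability space $(\Omega,\mathcal{A},\mathbb{P})$ such that for each fixed $\hat y$ the vectors $\hat Z^{\hat y}_1,\dots,\hat Z^{\hat y}_N$ are independent with distribution $P^{\hat y}$, and such that $(\hat y,\omega)\mapsto\hat Z^{\hat y}_j(\omega)$ is measurable on $\hat{\mathcal{Y}}\times\Omega$ for each $j$. Put $$\hat g_N(\hat y,\omega)=\frac1N\sum_{j=1}^N f\bigl(\hat W_1\hat y+\hat W_2\hat Z^{\hat y}_j(\omega)\bigr),\qquad f_{\hat g_N}(x,\omega)=\hat g_N(\hat W_1^\top x,\omega).$$ Then $$\int_\Omega\int_{\mathcal{X}}\bigl(f(x)-f_{\hat g_N}(x,\omega)\bigr)^2\,dP_X(x)\,d\mathbb{P}(\omega)\le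 C\,\bigl(1+N^{-1/2}\bigr)^2\Bigl(\varepsilon(\lambda_1+\dots+\lambda_k)^{1/2}+(\lambda_{k+1}+\dots+\lambda_n)^{1/2}\Bigr)^2 .$$ -/

import Mathlib

open MeasureTheory ProbabilityTheory

noncomputable section

namespace ActiveSubspace

/-- Indices `1, …, k` of the active coordinates; `EuclideanSpace ℝ (ActiveIdx n k)` is `ℝᵏ`. -/
abbrev ActiveIdx (n k : ℕ) : Type := {i : Fin n // (i : ℕ) < k}

/-- Indices `k+1, …, n` of the inactive coordinates;
`EuclideanSpace ℝ (InactiveIdx n k)` is `ℝⁿ⁻ᵏ`. -/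
abbrev InactiveIdx (n k : ℕ) : Type := {i : Fin n // ¬ (i : ℕ) < k}

variable {n : ℕ}

/-! ### Densities -/

/-- The set `𝒳` of points with positive density. -/
def domain (ρ : EuclideanSpace ℝ (Fin n) → ℝ) : Set (EuclideanSpace ℝ (Fin n)) :=
  {x | 0 < ρ x}

/-- The distribution `P_X` with Lebesgue density `ρ`. -/
def law (ρ : EuclideanSpace ℝ (Fin n) → ℝ) : Measure (EuclideanSpace ℝ (Fin n)) :=
  volume.withDensity fun x => ENNReal.ofReal (ρ x)

/-- The density of the uniform distribution on `S`. -/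
def uniformDensity (S : Set (EuclideanSpace ℝ (Fin n))) (x : EuclideanSpace ℝ (Fin n)) : ℝ :=
  S.indicator (fun _ => (volume.real S)⁻¹) x

/-- The density of the standard normal distribution `𝒩(0, I)` on `ℝⁿ`. -/
def stdNormalDensity (x : EuclideanSpace ℝ (Fin n)) : ℝ :=
  (2 * Real.pi) ^ (-(n : ℝ) / 2) * Real.exp (-‖x‖ ^ 2 / 2)

/-- The two cases considered: the uniform distribution on a nonempty, open, bounded, convex set,
and the standard normal distribution. -/
def IsUniformOrNormal (ρ : EuclideanSpace ℝ (Fin n) → ℝ) : Prop :=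
  (∃ S : Set (EuclideanSpace ℝ (Fin n)), S.Nonempty ∧ IsOpen S ∧ Bornology.IsBounded S ∧
    Convex ℝ S ∧ ρ = uniformDensity S) ∨ ρ = stdNormalDensity

/-! ### The averaged outer product of the gradient -/

/-- The `i`-th partial derivative of `f`. -/
def partialDeriv (f : EuclideanSpace ℝ (Fin n) → ℝ) (i : Fin n)
    (x : EuclideanSpace ℝ (Fin n)) : ℝ :=
  lineDeriv ℝ f x (EuclideanSpace.single i 1)

/-- `f` is a measurable function on `𝒳` all of whose partial derivatives exist on `𝒳` and are
square integrable with respect to `ρ`. (Only the values of `f` on `𝒳` matter.) -/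
structure HasSquareIntegrablePartials (ρ f : EuclideanSpace ℝ (Fin n) → ℝ) : Prop where
  measurable : Measurable fun x : domain ρ => f x
  differentiable : ∀ x ∈ domain ρ, ∀ i,
    LineDifferentiableAt ℝ f x (EuclideanSpace.single i (1 : ℝ))
  memLp : ∀ i, MemLp (partialDeriv f i) 2 (law ρ)

/-- The matrix `C = ∫_𝒳 ∇f(x) ∇f(x)ᵀ ρ(x) dx`. -/
def gradientMatrix (ρ f : EuclideanSpace ℝ (Fin n) → ℝ) : Matrix (Fin n) (Fin n) ℝ :=
  Matrix.of fun i j => ∫ x in domain ρ, partialDeriv f i x * partialDeriv f j x * ρ x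

/-- `C = W Λ Wᵀ` with `W` orthogonal and `Λ = diag(λ₁, …, λₙ)`, `λ₁ ≥ ⋯ ≥ λₙ`. -/
structure IsEigendecomposition (C W : Matrix (Fin n) (Fin n) ℝ) (lam : Fin n → ℝ) : Prop where
  orthogonal : W ∈ Matrix.orthogonalGroup (Fin n) ℝ
  antitone : Antitone lam
  eq : C = W * Matrix.diagonal lam * W.transpose

/-! ### Active and inactive variables -/

/-- `W₁`, the first `k` columns of `W`. -/
def activeBlock (W : Matrix (Fin n) (Fin n) ℝ) (k : ℕ) : Matrix (Fin n) (ActiveIdx n k) ℝ :=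
  W.submatrix id Subtype.val

/-- `W₂`, the last `n - k` columns of `W`. -/
def inactiveBlock (W : Matrix (Fin n) (Fin n) ℝ) (k : ℕ) :
    Matrix (Fin n) (InactiveIdx n k) ℝ :=
  W.submatrix id Subtype.val

/-- The active variable `y = W₁ᵀ x`. -/
def activeVar (W : Matrix (Fin n) (Fin n) ℝ) (k : ℕ) (x : EuclideanSpace ℝ (Fin n)) :
    EuclideanSpace ℝ (ActiveIdx n k) :=
  Matrix.toEuclideanLin (activeBlock W k).transpose x

/-- The point `W₁ y + W₂ z`. -/
def combine (W : Matrix (Fin n) (Fin n) ℝ) (k : ℕ) (y : EuclideanSpace ℝ (ActiveIdx n k))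
    (z : EuclideanSpace ℝ (InactiveIdx n k)) : EuclideanSpace ℝ (Fin n) :=
  Matrix.toEuclideanLin (activeBlock W k) y + Matrix.toEuclideanLin (inactiveBlock W k) z

/-- The set `𝒴 = W₁ᵀ 𝒳`. -/
def activeDomain (ρ : EuclideanSpace ℝ (Fin n) → ℝ) (W : Matrix (Fin n) (Fin n) ℝ) (k : ℕ) :
    Set (EuclideanSpace ℝ (ActiveIdx n k)) :=
  activeVar W k '' domain ρ

/-- The marginal density `ρ_Y(y) = ∫ ρ(W₁ y + W₂ z) dz`. -/
def marginalDensity (ρ : EuclideanSpace ℝ (Fin n) → ℝ) (W : Matrix (Fin n) (Fin n) ℝ) (k : ℕ)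
    (y : EuclideanSpace ℝ (ActiveIdx n k)) : ℝ :=
  ∫ z : EuclideanSpace ℝ (InactiveIdx n k), ρ (combine W k y z)

/-- The conditional density `ρ_{Z|Y}(z | y) = ρ(W₁ y + W₂ z) / ρ_Y(y)` (used for `y ∈ 𝒴`). -/
def condDensity (ρ : EuclideanSpace ℝ (Fin n) → ℝ) (W : Matrix (Fin n) (Fin n) ℝ) (k : ℕ)
    (y : EuclideanSpace ℝ (ActiveIdx n k)) (z : EuclideanSpace ℝ (InactiveIdx n k)) : ℝ :=
  ρ (combine W k y z) / marginalDensity ρ W k y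

/-- The conditional distribution of `Z` given `Y = y`, for `y ∈ 𝒴`. -/
def condLaw (ρ : EuclideanSpace ℝ (Fin n) → ℝ) (W : Matrix (Fin n) (Fin n) ℝ) (k : ℕ)
    (y : EuclideanSpace ℝ (ActiveIdx n k)) : Measure (EuclideanSpace ℝ (InactiveIdx n k)) :=
  volume.withDensity fun z => ENNReal.ofReal (condDensity ρ W k y z)

/-! ### Monte Carlo approximation -/

/-- `Z j y` (`j = 1, …, N`, `y ∈ 𝒴`) are Monte Carlo samples: for every fixed `y ∈ 𝒴` they are
independent with the conditional distribution of `Z` given `Y = y`, and each of them is a random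
field that is jointly measurable in `(y, ω) ∈ 𝒴 × Ω`. -/
structure IsMonteCarloSample {Ω : Type*} [MeasurableSpace Ω] (P : Measure Ω)
    (ρ : EuclideanSpace ℝ (Fin n) → ℝ) (W : Matrix (Fin n) (Fin n) ℝ) (k N : ℕ)
    (Z : Fin N → EuclideanSpace ℝ (ActiveIdx n k) → Ω → EuclideanSpace ℝ (InactiveIdx n k)) :
    Prop where
  measurable : ∀ j, Measurable fun p : activeDomain ρ W k × Ω => Z j p.1 p.2
  map_eq : ∀ y ∈ activeDomain ρ W k, ∀ j, P.map (Z j y) = condLaw ρ W k y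
  indep : ∀ y ∈ activeDomain ρ W k, iIndepFun (fun j => Z j y) P

/-- `g_N(y, ω) = (1/N) ∑ⱼ f(W₁ y + W₂ Zⱼʸ(ω))`. -/
def monteCarlo {Ω : Type*} (f : EuclideanSpace ℝ (Fin n) → ℝ) (W : Matrix (Fin n) (Fin n) ℝ)
    (k N : ℕ)
    (Z : Fin N → EuclideanSpace ℝ (ActiveIdx n k) → Ω → EuclideanSpace ℝ (InactiveIdx n k))
    (y : EuclideanSpace ℝ (ActiveIdx n k)) (ω : Ω) : ℝ :=
  1 / (N : ℝ) * ∑ j, f (combine W k y (Z j y ω))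

/-- `f_{g_N}(x, ω) = g_N(W₁ᵀ x, ω)`. -/
def ridgeMonteCarlo {Ω : Type*} (f : EuclideanSpace ℝ (Fin n) → ℝ)
    (W : Matrix (Fin n) (Fin n) ℝ) (k N : ℕ)
    (Z : Fin N → EuclideanSpace ℝ (ActiveIdx n k) → Ω → EuclideanSpace ℝ (InactiveIdx n k))
    (x : EuclideanSpace ℝ (Fin n)) (ω : Ω) : ℝ :=
  monteCarlo f W k N Z (activeVar W k x) ω

end ActiveSubspace

end

noncomputable section

namespace ActiveSubspace

open scoped ENNReal Topology Convolution
open Filter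

variable {n : ℕ}

/-! ### Inequalities for integrals of functions along paths -/

/-! Everything is reduced to one quantity: the mean of `(f(Y, Z) - f(Y, Z'))²`, where `Z` and `Z'`
are two conditionally independent copies of the inactive variable given the active variable `Y`,
both taken with respect to `What`. By convexity of the square, the error of a sample mean is at most
the average of the errors of the single samples, and each of these has exactly that mean
(`IsMonteCarloSample.lintegral_error_le`). So the Monte Carlo error is bounded without a factor
depending on `N`, and the factor `(1 + N^(-1/2))² ≥ 1` in the claim is slack.

The pair quantity is controlled by a Poincaré inequality on every slice of fixed `Y`, with a
constant independent of the slice. It comes from integrating the gradient along a path joining the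
two points. On a convex slice the path is a segment, split at its midpoint so that each half can be
compared with volume near its own end (`lintegral_pairs_le_of_convex`). For a Gaussian slice the
path is the arc `cos θ z + sin θ z'`, and rotation invariance of the product Gaussian removes the
dependence on `θ` (`lintegral_prod_pairs_le_gaussWeight`).

Since `f` has partial derivatives but need not be `C¹`, the inequality is proved for `C¹` functions
on an exhaustion of the domain and transferred in two limits, each by Fatou's lemma: mollification
of bounded functions (`exists_smooth_approx`, `lintegral_pairDiff_le_of_bounded`), then truncation
by a sine together with the exhaustion (`lintegral_pairDiff_le`).

The right-hand side is now the energy of the gradient along the inactive columns `ŵ_j`, namely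
`∑_{j>k} ŵ_jᵀ C ŵ_j = ∑_l λ_l ∑_{j>k} (w_l · ŵ_j)²`. The inner sum is at most `1` by Bessel; for `l
≤ k` it is at most `ε²`, because `w_l · ŵ_j = (w_l - ŵ_l) · ŵ_j` (`inactiveEnergy_le`). -/

lemma sq_lintegral_le {α : Type*} [MeasurableSpace α] (ν : Measure α) {g : α → ℝ≥0∞}
    (hg : AEMeasurable g ν) : (∫⁻ x, g x ∂ν) ^ 2 ≤ ν Set.univ * ∫⁻ x, g x ^ 2 ∂ν := by
  have h := ENNReal.lintegral_mul_norm_pow_le (μ := ν) (f := fun _ => 1) (g := fun x => g x ^ 2)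
    aemeasurable_const (hg.pow_const 2) (p := 1 / 2) (q := 1 / 2) (by norm_num) (by norm_num)
    (by norm_num)
  have h2 : ∀ a : ℝ≥0∞, (a ^ 2) ^ (1 / 2 : ℝ) = a := fun a => by
    rw [← ENNReal.rpow_natCast, ← ENNReal.rpow_mul]; norm_num
  have h3 : ∀ a : ℝ≥0∞, (a ^ (1 / 2 : ℝ)) ^ 2 = a := fun a => by
    rw [← ENNReal.rpow_natCast, ← ENNReal.rpow_mul]; norm_num
  simp only [h2, ENNReal.one_rpow, one_mul, lintegral_one] at h
  calc _ ≤ _ := pow_le_pow_left' h 2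
    _ = _ := by rw [mul_pow, h3, h3]

lemma enorm_sub_sq_le_two_mul (a b m : ℝ) :
    ‖a - b‖ₑ ^ 2 ≤ 2 * ‖a - m‖ₑ ^ 2 + 2 * ‖b - m‖ₑ ^ 2 := by
  simp only [Real.enorm_eq_ofReal_abs, ← ENNReal.ofReal_pow (abs_nonneg _), sq_abs]
  rw [show (2 : ℝ≥0∞) = ENNReal.ofReal 2 by simp, ← ENNReal.ofReal_mul (by norm_num),
    ← ENNReal.ofReal_mul (by norm_num), ← ENNReal.ofReal_add (by positivity) (by positivity)]
  exact ENNReal.ofReal_le_ofReal (by nlinarith [sq_nonneg (a - m + (b - m))])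

/-- Fundamental theorem of calculus along the path, then Cauchy–Schwarz in the parameter. Both
Poincaré inequalities below start here and differ only in the choice of path. -/
lemma enorm_sub_sq_le_lintegral_path {E : Type*} [NormedAddCommGroup E] [NormedSpace ℝ E]
    {g : E → ℝ} (hg : ContDiff ℝ 1 g) {c c' : ℝ → E} (hc : ∀ θ, HasDerivAt c (c' θ) θ)
    (hc' : Continuous c') {L : ℝ} (hL : 0 ≤ L) :
    ‖g (c 0) - g (c L)‖ₑ ^ 2 ≤
      ENNReal.ofReal L * ∫⁻ θ in Set.Ioc 0 L, (‖fderiv ℝ g (c θ)‖ₑ * ‖c' θ‖ₑ) ^ 2 := by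
  have hcc : Continuous c := continuous_iff_continuousAt.2 fun θ => (hc θ).continuousAt
  have hgc : Continuous (fderiv ℝ g) := hg.continuous_fderiv (by simp)
  have hd : Continuous fun θ => fderiv ℝ g (c θ) := hgc.comp hcc
  have hcont : Continuous fun θ => fderiv ℝ g (c θ) (c' θ) := hd.clm_apply hc'
  have h1 : ∫ θ in (0 : ℝ)..L, fderiv ℝ g (c θ) (c' θ) = g (c L) - g (c 0) := by
    apply intervalIntegral.integral_eq_sub_of_hasDerivAt (f := fun θ => g (c θ))
    · intro θ _
      exact ((hg.differentiable (by simp)) (c θ)).hasFDerivAt.comp_hasDerivAt θ (hc θ)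
    · exact hcont.intervalIntegrable _ _
  rw [intervalIntegral.integral_of_le hL] at h1
  calc ‖g (c 0) - g (c L)‖ₑ ^ 2 = ‖g (c L) - g (c 0)‖ₑ ^ 2 := by rw [← enorm_neg, neg_sub]
    _ = ‖∫ θ in Set.Ioc 0 L, fderiv ℝ g (c θ) (c' θ)‖ₑ ^ 2 := by rw [h1]
    _ ≤ (∫⁻ θ in Set.Ioc 0 L, ‖fderiv ℝ g (c θ)‖ₑ * ‖c' θ‖ₑ) ^ 2 := by
        gcongr
        refine (enorm_integral_le_lintegral_enorm _).trans (lintegral_mono fun θ => ?_)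
        exact ContinuousLinearMap.le_opENorm _ _
    _ ≤ _ := by
        refine (sq_lintegral_le _ ?_).trans (le_of_eq ?_)
        · exact (hd.measurable.enorm.mul hc'.enorm.measurable).aemeasurable
        · simp

/-! ### A Poincaré inequality on bounded convex sets -/

section Convex

variable {ι : Type*} [Fintype ι]

/-- The contraction of `K` towards `z'` maps `K` into itself and scales volume by `(1 - θ)^d`. Its
inverse Jacobian is at most `2^d` as long as `θ ≤ 1/2`, which is why segments are followed only up
to their midpoint. -/
lemma lintegral_comp_segment_le {K : Set (EuclideanSpace ℝ ι)} (hK : Convex ℝ K)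
    (hKm : MeasurableSet K) {H : EuclideanSpace ℝ ι → ℝ≥0∞} (hH : Measurable H)
    {z' : EuclideanSpace ℝ ι} (hz' : z' ∈ K) {θ : ℝ} (h0 : 0 ≤ θ) (h1 : θ ≤ 1 / 2) :
    ∫⁻ z in K, H (z + θ • (z' - z)) ≤ 2 ^ Fintype.card ι * ∫⁻ z in K, H z := by
  have hpos : (0 : ℝ) < 1 - θ := by linarith
  have hmap : Measure.map ((1 - θ) • ·) (volume : Measure (EuclideanSpace ℝ ι)) =
      ENNReal.ofReal |((1 - θ) ^ Fintype.card ι)⁻¹| • volume := by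
    rw [Measure.map_addHaar_smul _ hpos.ne', finrank_euclideanSpace]
  have hF : Measurable (K.indicator H) := hH.indicator hKm
  calc ∫⁻ z in K, H (z + θ • (z' - z))
      = ∫⁻ z, K.indicator (fun z => H (z + θ • (z' - z))) z := (lintegral_indicator hKm _).symm
    _ ≤ ∫⁻ z, K.indicator H ((1 - θ) • z + θ • z') := by
        refine lintegral_mono fun z => ?_
        by_cases hz : z ∈ K
        · have e : z + θ • (z' - z) = (1 - θ) • z + θ • z' := by module
          have hmem : (1 - θ) • z + θ • z' ∈ K := hK hz hz' hpos.le h0 (by ring)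
          simp [e, Set.indicator_of_mem hmem, Set.indicator_of_mem hz]
        · simp [Set.indicator_of_notMem hz]
    _ = ∫⁻ u, K.indicator H (u + θ • z') ∂(Measure.map ((1 - θ) • ·) volume) := by
        rw [lintegral_map (by fun_prop) (by fun_prop)]
    _ = ENNReal.ofReal |((1 - θ) ^ Fintype.card ι)⁻¹| * ∫⁻ u, K.indicator H (u + θ • z') := by
        rw [hmap, lintegral_smul_measure, smul_eq_mul]
    _ = ENNReal.ofReal |((1 - θ) ^ Fintype.card ι)⁻¹| * ∫⁻ z in K, H z := by
        rw [lintegral_add_right_eq_self (K.indicator H), lintegral_indicator hKm]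
    _ ≤ _ := by
        gcongr
        rw [show (2 : ℝ≥0∞) ^ Fintype.card ι = ENNReal.ofReal (2 ^ Fintype.card ι) by
          rw [ENNReal.ofReal_pow (by norm_num)]; simp]
        refine ENNReal.ofReal_le_ofReal ?_
        rw [abs_of_nonneg (by positivity), ← inv_pow]
        exact pow_le_pow_left₀ (by positivity) (by
          rw [inv_le_comm₀ hpos (by norm_num)]; linarith) _

/-- Integrate along the half segment starting at `z`; with `z'` fixed, Fubini leaves a contraction
of `K` for each `θ`. The factor `1/4` is the parameter length `1/2` used twice, in Cauchy–Schwarz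
and in the integral over `θ`. -/
lemma lintegral_midpoint_le {K : Set (EuclideanSpace ℝ ι)} (hK : Convex ℝ K)
    (hKm : MeasurableSet K) {d : ℝ} (hd : ∀ z ∈ K, ∀ z' ∈ K, ‖z' - z‖ ≤ d)
    {g : EuclideanSpace ℝ ι → ℝ} (hg : ContDiff ℝ 1 g) :
    ∫⁻ z' in K, ∫⁻ z in K, ‖g z - g (z + (1 / 2 : ℝ) • (z' - z))‖ₑ ^ 2 ≤
      ENNReal.ofReal (1 / 4) * ENNReal.ofReal d ^ 2 * 2 ^ Fintype.card ι * volume K *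
        ∫⁻ z in K, ‖fderiv ℝ g z‖ₑ ^ 2 := by
  have hgc : Continuous (fderiv ℝ g) := hg.continuous_fderiv (by simp)
  set H : EuclideanSpace ℝ ι → ℝ≥0∞ := fun z => ‖fderiv ℝ g z‖ₑ ^ 2 with hHdef
  have hH : Measurable H := hgc.measurable.enorm.pow_const 2
  have hin : ∀ z' ∈ K, ∫⁻ z in K, ‖g z - g (z + (1 / 2 : ℝ) • (z' - z))‖ₑ ^ 2 ≤
      ENNReal.ofReal (1 / 4) * ENNReal.ofReal d ^ 2 * 2 ^ Fintype.card ι * ∫⁻ z in K, H z := by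
    intro z' hz'
    calc ∫⁻ z in K, ‖g z - g (z + (1 / 2 : ℝ) • (z' - z))‖ₑ ^ 2
        ≤ ∫⁻ z in K, ENNReal.ofReal (1 / 2) * ∫⁻ θ in Set.Ioc (0 : ℝ) (1 / 2),
            H (z + θ • (z' - z)) * ENNReal.ofReal d ^ 2 := by
          refine setLIntegral_mono' hKm fun z hz => ?_
          have := enorm_sub_sq_le_lintegral_path hg (c := fun θ : ℝ => z + θ • (z' - z))
            (c' := fun _ => z' - z) (fun θ => by
              simpa using ((hasDerivAt_id θ).smul_const (z' - z)).const_add z)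
            continuous_const (L := 1 / 2) (by norm_num)
          simp only [zero_smul, add_zero] at this
          refine this.trans ?_
          gcongr with θ
          rw [mul_pow]
          gcongr
          rw [← ofReal_norm]
          exact ENNReal.ofReal_le_ofReal (hd z hz z' hz')
      _ = ENNReal.ofReal (1 / 2) * ∫⁻ θ in Set.Ioc (0 : ℝ) (1 / 2), ∫⁻ z in K,
            H (z + θ • (z' - z)) * ENNReal.ofReal d ^ 2 := by
          rw [lintegral_const_mul' _ _ ENNReal.ofReal_ne_top, lintegral_lintegral_swap]
          apply Measurable.aemeasurable
          exact (hH.comp (g := H) (f := fun p : EuclideanSpace ℝ ι × ℝ => p.1 + p.2 • (z' - p.1))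
            (by fun_prop)).mul_const _
      _ ≤ ENNReal.ofReal (1 / 2) * ∫⁻ θ in Set.Ioc (0 : ℝ) (1 / 2),
            2 ^ Fintype.card ι * (∫⁻ z in K, H z) * ENNReal.ofReal d ^ 2 := by
          refine mul_le_mul' le_rfl (setLIntegral_mono' measurableSet_Ioc fun θ hθ => ?_)
          rw [lintegral_mul_const' _ _ (by finiteness)]
          gcongr
          exact lintegral_comp_segment_le hK hKm hH hz' hθ.1.le hθ.2
      _ = _ := by
          rw [lintegral_const, Measure.restrict_apply_univ, Real.volume_Ioc, sub_zero,
            show ENNReal.ofReal (1 / 4) = ENNReal.ofReal (1 / 2) * ENNReal.ofReal (1 / 2) by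
              rw [← ENNReal.ofReal_mul (by norm_num)]; norm_num]
          ring
  calc _ ≤ ∫⁻ z' in K, ENNReal.ofReal (1 / 4) * ENNReal.ofReal d ^ 2 * 2 ^ Fintype.card ι *
        ∫⁻ z in K, H z := setLIntegral_mono' hKm hin
    _ = _ := by rw [setLIntegral_const]; ring

/-- Compare both values with the value at the midpoint. The two halves are exchanged by swapping `z`
and `z'`, so they contribute equally, and the total factor `4` cancels the `1/4` of the half-segment
estimate. -/
theorem lintegral_pairs_le_of_convex {K : Set (EuclideanSpace ℝ ι)} (hK : Convex ℝ K)
    (hKm : MeasurableSet K) {d : ℝ} (hd : ∀ z ∈ K, ∀ z' ∈ K, ‖z' - z‖ ≤ d)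
    {g : EuclideanSpace ℝ ι → ℝ} (hg : ContDiff ℝ 1 g) :
    ∫⁻ z in K, ∫⁻ z' in K, ‖g z - g z'‖ₑ ^ 2 ≤
      ENNReal.ofReal d ^ 2 * 2 ^ Fintype.card ι * volume K *
        ∫⁻ z in K, ‖fderiv ℝ g z‖ₑ ^ 2 := by
  have hgm : Continuous g := hg.continuous
  have hq : Measurable fun p : EuclideanSpace ℝ ι × EuclideanSpace ℝ ι =>
      ‖g p.1 - g (p.1 + (1 / 2 : ℝ) • (p.2 - p.1))‖ₑ ^ 2 := by
    apply Measurable.pow_const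
    apply Measurable.enorm
    exact (Continuous.sub (by fun_prop) (hgm.comp (by fun_prop))).measurable
  have hq' : Measurable fun p : EuclideanSpace ℝ ι × EuclideanSpace ℝ ι =>
      ‖g p.2 - g (p.2 + (1 / 2 : ℝ) • (p.1 - p.2))‖ₑ ^ 2 := hq.comp measurable_swap
  have key := lintegral_midpoint_le hK hKm hd hg
  calc ∫⁻ z in K, ∫⁻ z' in K, ‖g z - g z'‖ₑ ^ 2
      ≤ ∫⁻ z in K, ∫⁻ z' in K, (2 * ‖g z - g (z + (1 / 2 : ℝ) • (z' - z))‖ₑ ^ 2 +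
          2 * ‖g z' - g (z' + (1 / 2 : ℝ) • (z - z'))‖ₑ ^ 2) := by
        gcongr with z z'
        have e : z' + (1 / 2 : ℝ) • (z - z') = z + (1 / 2 : ℝ) • (z' - z) := by
          module
        rw [e]
        exact enorm_sub_sq_le_two_mul _ _ _
    _ = 2 * (∫⁻ z in K, ∫⁻ z' in K, ‖g z - g (z + (1 / 2 : ℝ) • (z' - z))‖ₑ ^ 2) +
        2 * ∫⁻ z in K, ∫⁻ z' in K, ‖g z' - g (z' + (1 / 2 : ℝ) • (z - z'))‖ₑ ^ 2 := by
        have hi : ∀ z : EuclideanSpace ℝ ι, ∫⁻ z' in K,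
            (2 * ‖g z - g (z + (1 / 2 : ℝ) • (z' - z))‖ₑ ^ 2 +
              2 * ‖g z' - g (z' + (1 / 2 : ℝ) • (z - z'))‖ₑ ^ 2) =
            2 * (∫⁻ z' in K, ‖g z - g (z + (1 / 2 : ℝ) • (z' - z))‖ₑ ^ 2) +
              2 * ∫⁻ z' in K, ‖g z' - g (z' + (1 / 2 : ℝ) • (z - z'))‖ₑ ^ 2 := by
          intro z
          have hm : Measurable fun z' => 2 * ‖g z - g (z + (1 / 2 : ℝ) • (z' - z))‖ₑ ^ 2 :=
            (hq.comp (measurable_prodMk_left (x := z))).const_mul 2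
          rw [lintegral_add_left hm,
            lintegral_const_mul' _ _ (by simp), lintegral_const_mul' _ _ (by simp)]
        simp_rw [hi]
        rw [lintegral_add_left (hq.lintegral_prod_right'.const_mul 2),
          lintegral_const_mul' _ _ (by simp), lintegral_const_mul' _ _ (by simp)]
    _ = 4 * ∫⁻ z' in K, ∫⁻ z in K, ‖g z - g (z + (1 / 2 : ℝ) • (z' - z))‖ₑ ^ 2 := by
        rw [lintegral_lintegral_swap (f := fun z z' : EuclideanSpace ℝ ι =>
          ‖g z - g (z + (1 / 2 : ℝ) • (z' - z))‖ₑ ^ 2) hq.aemeasurable, ← add_mul]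
        norm_num
    _ ≤ 4 * _ := mul_le_mul' le_rfl key
    _ = _ := by
        simp only [← mul_assoc]
        rw [show (4 : ℝ≥0∞) * ENNReal.ofReal (1 / 4) = 1 by
          rw [show (4 : ℝ≥0∞) = ENNReal.ofReal 4 by simp, ← ENNReal.ofReal_mul (by norm_num)]
          norm_num, one_mul]

theorem lintegral_prod_pairs_le_of_convex {K : Set (EuclideanSpace ℝ ι)} (hK : Convex ℝ K)
    (hKm : MeasurableSet K) {d : ℝ} (hd : ∀ z ∈ K, ∀ z' ∈ K, ‖z' - z‖ ≤ d)
    {g : EuclideanSpace ℝ ι → ℝ} (hg : ContDiff ℝ 1 g) :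
    ∫⁻ p in K ×ˢ K, ‖g p.1 - g p.2‖ₑ ^ 2 ≤
      ENNReal.ofReal d ^ 2 * 2 ^ Fintype.card ι * volume K *
        ∫⁻ z in K, ‖fderiv ℝ g z‖ₑ ^ 2 := by
  rw [Measure.volume_eq_prod, ← Measure.prod_restrict, lintegral_prod]
  · exact lintegral_pairs_le_of_convex hK hKm hd hg
  · have := hg.continuous
    apply Measurable.aemeasurable
    apply Measurable.pow_const
    apply Measurable.enorm
    exact Continuous.measurable (by fun_prop)

end Convex

/-! ### A Poincaré inequality for Gaussian weights -/

section Gaussian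

variable {ι : Type*} [Fintype ι]

/-- The weight `exp (-‖z‖² / 2)`. -/
def gaussWeight (z : EuclideanSpace ℝ ι) : ℝ≥0∞ := ENNReal.ofReal (Real.exp (-‖z‖ ^ 2 / 2))

lemma measurable_gaussWeight : Measurable (gaussWeight (ι := ι)) := by
  unfold gaussWeight
  fun_prop

/-- The rotation `(z, z') ↦ (cos θ z + sin θ z', -sin θ z + cos θ z')`. -/
def rotate (θ : ℝ) (p : EuclideanSpace ℝ ι × EuclideanSpace ℝ ι) :
    EuclideanSpace ℝ ι × EuclideanSpace ℝ ι :=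
  (Real.cos θ • p.1 + Real.sin θ • p.2, -Real.sin θ • p.1 + Real.cos θ • p.2)

lemma norm_sq_rotate (θ : ℝ) (p : EuclideanSpace ℝ ι × EuclideanSpace ℝ ι) :
    ‖(rotate θ p).1‖ ^ 2 + ‖(rotate θ p).2‖ ^ 2 = ‖p.1‖ ^ 2 + ‖p.2‖ ^ 2 := by
  simp only [rotate, norm_add_sq_real, norm_smul, real_inner_smul_left, real_inner_smul_right,
    mul_pow, Real.norm_eq_abs, sq_abs]
  have := Real.sin_sq_add_cos_sq θ
  linear_combination (‖p.1‖ ^ 2 + ‖p.2‖ ^ 2) * this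

lemma gaussWeight_rotate (θ : ℝ) (p : EuclideanSpace ℝ ι × EuclideanSpace ℝ ι) :
    gaussWeight (rotate θ p).1 * gaussWeight (rotate θ p).2 =
      gaussWeight p.1 * gaussWeight p.2 := by
  simp only [gaussWeight]
  rw [← ENNReal.ofReal_mul (Real.exp_pos _).le, ← ENNReal.ofReal_mul (Real.exp_pos _).le,
    ← Real.exp_add, ← Real.exp_add]
  congr 2
  linarith [norm_sq_rotate θ p]

/-- The product type carries the sup norm, for which the rotation is no isometry. On `WithLp 2` it
is a linear isometry, and both passages between the two types preserve volume. -/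
lemma measurePreserving_rotate (θ : ℝ) :
    MeasurePreserving (rotate (ι := ι) θ) volume volume := by
  let V := EuclideanSpace ℝ ι
  let L : WithLp 2 (V × V) →ₗ[ℝ] WithLp 2 (V × V) :=
    { toFun := fun p => WithLp.toLp 2 (rotate θ (WithLp.ofLp p))
      map_add' := fun p q => by
        refine WithLp.ofLp_injective 2 (Prod.ext ?_ ?_) <;> simp [rotate] <;> module
      map_smul' := fun r p => by
        refine WithLp.ofLp_injective 2 (Prod.ext ?_ ?_) <;> simp [rotate] <;> module }
  have hL : ∀ p, ‖L p‖ = ‖p‖ := fun p => by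
    rw [← sq_eq_sq₀ (norm_nonneg _) (norm_nonneg _), WithLp.prod_norm_sq_eq_of_L2,
      WithLp.prod_norm_sq_eq_of_L2]
    exact norm_sq_rotate θ (WithLp.ofLp p)
  let e : WithLp 2 (V × V) ≃ₗᵢ[ℝ] WithLp 2 (V × V) :=
    LinearIsometry.toLinearIsometryEquiv ⟨L, hL⟩ rfl
  exact ((WithLp.volume_preserving_ofLp V V).comp e.measurePreserving).comp
    (WithLp.volume_preserving_toLp V V)

/-- Along the arc from `z` to `z'`, position and velocity are the two components of the rotated
pair. With the rotation-invariant weight, the integrand at `θ` is therefore a fixed function `H`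
composed with `rotate θ`, whose full integral does not depend on `θ`. `H` factors into a gradient
energy and a second moment. The set `B` has to contain all arcs between points of `A`. -/
theorem lintegral_prod_pairs_le_gaussWeight {A B : Set (EuclideanSpace ℝ ι)}
    (hA : MeasurableSet A) (hB : MeasurableSet B)
    (hAB : ∀ z ∈ A, ∀ z' ∈ A, ∀ θ : ℝ, Real.cos θ • z + Real.sin θ • z' ∈ B)
    {g : EuclideanSpace ℝ ι → ℝ} (hg : ContDiff ℝ 1 g) :
    ∫⁻ p in A ×ˢ A, ‖g p.1 - g p.2‖ₑ ^ 2 * (gaussWeight p.1 * gaussWeight p.2) ≤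
      ENNReal.ofReal (Real.pi / 2) ^ 2 *
        (∫⁻ z : EuclideanSpace ℝ ι, ‖z‖ₑ ^ 2 * gaussWeight z) *
        ∫⁻ z in B, ‖fderiv ℝ g z‖ₑ ^ 2 * gaussWeight z := by
  have hgc : Continuous (fderiv ℝ g) := hg.continuous_fderiv (by simp)
  have hGm := measurable_gaussWeight (ι := ι)
  have hpi : 0 ≤ Real.pi / 2 := by positivity
  set H : EuclideanSpace ℝ ι × EuclideanSpace ℝ ι → ℝ≥0∞ := fun p =>
    (B.indicator (fun z => ‖fderiv ℝ g z‖ₑ ^ 2 * gaussWeight z) p.1) *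
      (‖p.2‖ₑ ^ 2 * gaussWeight p.2) with hH
  have h1 : Measurable fun z => B.indicator (fun z => ‖fderiv ℝ g z‖ₑ ^ 2 * gaussWeight z) z :=
    ((hgc.measurable.enorm.pow_const 2).mul hGm).indicator hB
  have h2 : Measurable fun z : EuclideanSpace ℝ ι => ‖z‖ₑ ^ 2 * gaussWeight z :=
    (measurable_enorm.pow_const 2).mul hGm
  have hHm : Measurable H := (h1.comp measurable_fst).mul (h2.comp measurable_snd)
  have hrot : Measurable fun q : (EuclideanSpace ℝ ι × EuclideanSpace ℝ ι) × ℝ =>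
      rotate q.2 q.1 := by
    unfold rotate
    fun_prop
  have hHint : ∫⁻ p, H p = (∫⁻ z in B, ‖fderiv ℝ g z‖ₑ ^ 2 * gaussWeight z) *
      ∫⁻ z : EuclideanSpace ℝ ι, ‖z‖ₑ ^ 2 * gaussWeight z := by
    rw [Measure.volume_eq_prod, lintegral_prod_mul h1.aemeasurable h2.aemeasurable,
      lintegral_indicator hB]
  calc ∫⁻ p in A ×ˢ A, ‖g p.1 - g p.2‖ₑ ^ 2 * (gaussWeight p.1 * gaussWeight p.2)
      ≤ ∫⁻ p in A ×ˢ A, ENNReal.ofReal (Real.pi / 2) *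
          ∫⁻ θ in Set.Ioc 0 (Real.pi / 2), H (rotate θ p) := by
        refine setLIntegral_mono' (hA.prod hA) fun p hp => ?_
        have := enorm_sub_sq_le_lintegral_path hg
          (c := fun θ : ℝ => Real.cos θ • p.1 + Real.sin θ • p.2)
          (c' := fun θ => -Real.sin θ • p.1 + Real.cos θ • p.2) (fun θ =>
            ((Real.hasDerivAt_cos θ).smul_const p.1).add ((Real.hasDerivAt_sin θ).smul_const p.2))
          (by fun_prop) hpi
        simp only [Real.cos_zero, Real.sin_zero, Real.cos_pi_div_two, Real.sin_pi_div_two,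
          one_smul, zero_smul, add_zero, zero_add] at this
        calc _ ≤ _ := mul_le_mul_left this _
          _ = ENNReal.ofReal (Real.pi / 2) * ∫⁻ θ in Set.Ioc 0 (Real.pi / 2),
              (‖fderiv ℝ g (rotate θ p).1‖ₑ * ‖(rotate θ p).2‖ₑ) ^ 2 *
                (gaussWeight p.1 * gaussWeight p.2) := by
              rw [mul_assoc, lintegral_mul_const' _ _ (by simp only [gaussWeight]; finiteness)]
              rfl
          _ = _ := by
              congr 1
              refine lintegral_congr fun θ => ?_
              have hmem : (rotate θ p).1 ∈ B := hAB _ hp.1 _ hp.2 θ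
              rw [hH, ← gaussWeight_rotate θ p]
              simp only [Set.indicator_of_mem hmem]
              ring
    _ = ENNReal.ofReal (Real.pi / 2) * ∫⁻ θ in Set.Ioc 0 (Real.pi / 2), ∫⁻ p in A ×ˢ A,
          H (rotate θ p) := by
        rw [lintegral_const_mul' _ _ ENNReal.ofReal_ne_top, lintegral_lintegral_swap]
        exact (hHm.comp hrot).aemeasurable
    _ ≤ ENNReal.ofReal (Real.pi / 2) * ∫⁻ θ in Set.Ioc 0 (Real.pi / 2), ∫⁻ p, H p := by
        refine mul_le_mul' le_rfl (lintegral_mono fun θ => ?_)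
        calc _ ≤ ∫⁻ p, H (rotate θ p) := setLIntegral_le_lintegral _ _
          _ = _ := (measurePreserving_rotate θ).lintegral_comp hHm
    _ = _ := by
        rw [lintegral_const, Measure.restrict_apply_univ, Real.volume_Ioc, sub_zero, hHint]
        ring

lemma integrable_exp_neg_mul_sq_norm {b : ℝ} (hb : 0 < b) :
    Integrable fun z : EuclideanSpace ℝ ι => Real.exp (-b * ‖z‖ ^ 2) := by
  have := (GaussianFourier.integrable_cexp_neg_mul_sq_norm_add (V := EuclideanSpace ℝ ι)
    (b := (b : ℂ)) (by simpa using hb) 0 0).norm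
  refine this.congr (Filter.Eventually.of_forall fun z => ?_)
  simp [Complex.norm_exp, ← Complex.ofReal_pow]

/-- From `s ≤ exp s` at `s = ‖z‖² / 4`, the integrand is at most `4 exp (-‖z‖² / 4)`. -/
lemma lintegral_sq_mul_gaussWeight_ne_top :
    ∫⁻ z : EuclideanSpace ℝ ι, ‖z‖ₑ ^ 2 * gaussWeight z ≠ ∞ := by
  have h := ((integrable_exp_neg_mul_sq_norm (ι := ι) (b := 1 / 4)
    (by norm_num)).const_mul 4).lintegral_lt_top
  refine (lt_of_le_of_lt (lintegral_mono fun z => ?_) h).ne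
  rw [gaussWeight, ← ofReal_norm, ← ENNReal.ofReal_pow (norm_nonneg _),
    ← ENNReal.ofReal_mul (by positivity)]
  apply ENNReal.ofReal_le_ofReal
  have h1 : ‖z‖ ^ 2 / 4 ≤ Real.exp (‖z‖ ^ 2 / 4) := by
    linarith [Real.add_one_le_exp (‖z‖ ^ 2 / 4)]
  have h2 : Real.exp (-(1 / 4) * ‖z‖ ^ 2) = Real.exp (‖z‖ ^ 2 / 4) * Real.exp (-‖z‖ ^ 2 / 2) := by
    rw [← Real.exp_add]; congr 1; ring
  rw [h2]
  nlinarith [Real.exp_pos (-‖z‖ ^ 2 / 2)]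

end Gaussian

/-! ### Smoothing functions with partial derivatives -/

/-- On `U` the partial derivative is the pointwise limit of the difference quotients with step `1 /
(m + 1)`, each of which is measurable. -/
lemma measurable_indicator_partialDeriv {U : Set (EuclideanSpace ℝ (Fin n))}
    (hU : MeasurableSet U) {f : EuclideanSpace ℝ (Fin n) → ℝ} (hf : Measurable f) {i : Fin n}
    (hd : ∀ x ∈ U, LineDifferentiableAt ℝ f x (EuclideanSpace.single i (1 : ℝ))) :
    Measurable (U.indicator (partialDeriv f i)) := by
  have hseq : Tendsto (fun m : ℕ => 1 / ((m : ℝ) + 1)) atTop (𝓝[≠] 0) :=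
    tendsto_nhdsWithin_iff.2 ⟨tendsto_one_div_add_atTop_nhds_zero_nat,
      Eventually.of_forall fun m => by simp; positivity⟩
  refine measurable_of_tendsto_metrizable (f := fun (m : ℕ) => U.indicator fun x =>
    (1 / ((m : ℝ) + 1))⁻¹ • (f (x + (1 / ((m : ℝ) + 1)) • EuclideanSpace.single i (1 : ℝ)) - f x))
    (fun m => ?_) (tendsto_pi_nhds.2 fun x => ?_)
  · refine Measurable.indicator ?_ hU
    have h : Measurable fun x =>
        f (x + (1 / ((m : ℝ) + 1)) • EuclideanSpace.single i (1 : ℝ)) - f x :=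
      (hf.comp (measurable_id.add_const _)).sub hf
    exact h.const_mul (1 / ((m : ℝ) + 1))⁻¹
  · by_cases hx : x ∈ U
    · simp only [Set.indicator_of_mem hx]
      exact ((hd x hx).hasLineDerivAt.tendsto_slope_zero).comp hseq
    · simp [Set.indicator_of_notMem hx]

/-- A weight bounded below turns the weighted bound into an unweighted square integral, and on a set
of finite measure Cauchy–Schwarz gives integrability. This supplies the local integrability of the
partial derivatives needed for mollification. -/
lemma integrableOn_of_weight {E : Type*} [MeasurableSpace E] {μ : Measure E} {D : E → ℝ}
    (hD : Measurable D) {r : E → ℝ≥0∞} (hfin : ∫⁻ u, ‖D u‖ₑ ^ 2 * r u ∂μ ≠ ∞)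
    {S : Set E} (hS : MeasurableSet S) (hμS : μ S ≠ ∞) {c : ℝ≥0∞} (hc : c ≠ 0) (hc' : c ≠ ∞)
    (hcr : ∀ u ∈ S, c ≤ r u) : IntegrableOn D S μ := by
  refine ⟨hD.aestronglyMeasurable, ?_⟩
  have h1 : ∫⁻ u in S, ‖D u‖ₑ ^ 2 ∂μ ≠ ∞ := by
    have h2 : c * ∫⁻ u in S, ‖D u‖ₑ ^ 2 ∂μ ≤ ∫⁻ u, ‖D u‖ₑ ^ 2 * r u ∂μ := by
      rw [← lintegral_const_mul' _ _ hc']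
      refine (setLIntegral_mono' hS fun u hu => ?_).trans (setLIntegral_le_lintegral S _)
      rw [mul_comm]
      gcongr
      exact hcr u hu
    intro h
    rw [h, ENNReal.mul_top hc] at h2
    exact hfin (top_le_iff.1 h2)
  have h3 := sq_lintegral_le (μ.restrict S) hD.enorm.aemeasurable
  rw [Measure.restrict_apply_univ] at h3
  have h4 : (∫⁻ u in S, ‖D u‖ₑ ∂μ) ^ 2 < ∞ := h3.trans_lt (ENNReal.mul_lt_top hμS.lt_top h1.lt_top)
  exact (ENNReal.pow_lt_top_iff.1 h4).resolve_right (by norm_num)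

/-- The mollification of `f` by a bump function. -/
def mollify (φ : ContDiffBump (0 : EuclideanSpace ℝ (Fin n)))
    (f : EuclideanSpace ℝ (Fin n) → ℝ) : EuclideanSpace ℝ (Fin n) → ℝ :=
  φ.normed volume ⋆[ContinuousLinearMap.lsmul ℝ ℝ, volume] f

section Mollify

variable {f : EuclideanSpace ℝ (Fin n) → ℝ} {M : ℝ}
  (φ : ContDiffBump (0 : EuclideanSpace ℝ (Fin n)))

lemma locallyIntegrable_of_bounded (hf : Measurable f) (hM : ∀ x, ‖f x‖ ≤ M) :
    LocallyIntegrable f volume :=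
  (locallyIntegrable_const M).mono hf.aestronglyMeasurable
    (Eventually.of_forall fun x => (hM x).trans (le_abs_self M))

lemma contDiff_mollify (hf : Measurable f) (hM : ∀ x, ‖f x‖ ≤ M) :
    ContDiff ℝ 1 (mollify φ f) :=
  HasCompactSupport.contDiff_convolution_left (n := 1) _ φ.hasCompactSupport_normed
    (φ.contDiff_normed (n := 1)) (locallyIntegrable_of_bounded hf hM)

lemma fderiv_mollify (hf : Measurable f) (hM : ∀ x, ‖f x‖ ≤ M)
    (x v : EuclideanSpace ℝ (Fin n)) :
    fderiv ℝ (mollify φ f) x v = ∫ t, fderiv ℝ (φ.normed volume) t v * f (x - t) := by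
  have hφ : ContDiff ℝ 1 (φ.normed volume) := φ.contDiff_normed
  have hloc := locallyIntegrable_of_bounded hf hM
  have h := HasCompactSupport.hasFDerivAt_convolution_left (ContinuousLinearMap.lsmul ℝ ℝ)
    φ.hasCompactSupport_normed hφ hloc x
  rw [show fderiv ℝ (mollify φ f) x = _ from h.fderiv, convolution_def,
    ContinuousLinearMap.integral_apply]
  · rfl
  · exact (HasCompactSupport.convolutionExists_left _ (φ.hasCompactSupport_normed.fderiv ℝ)
      (hφ.continuous_fderiv (by simp)) hloc x)

/-- Integration by parts moves the derivative from the bump onto `f`. It is legitimate with no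
continuity of the partial derivative: existence at every point of the bump's support and
integrability of the products suffice. The ball condition keeps the points `x - t` inside `U`, where
the derivative exists. -/
lemma fderiv_mollify_single (hf : Measurable f) (hM : ∀ x, ‖f x‖ ≤ M)
    {U : Set (EuclideanSpace ℝ (Fin n))} (hU : MeasurableSet U) {i : Fin n}
    (hd : ∀ x ∈ U, LineDifferentiableAt ℝ f x (EuclideanSpace.single i (1 : ℝ)))
    {x : EuclideanSpace ℝ (Fin n)} (hx : Metric.closedBall x φ.rOut ⊆ U)
    (hint : IntegrableOn (U.indicator (partialDeriv f i)) (Metric.closedBall x φ.rOut)) :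
    Integrable (fun t => φ.normed volume t * U.indicator (partialDeriv f i) (x - t)) ∧
    fderiv ℝ (mollify φ f) x (EuclideanSpace.single i (1 : ℝ)) =
      ∫ t, φ.normed volume t * U.indicator (partialDeriv f i) (x - t) := by
  set e : EuclideanSpace ℝ (Fin n) := EuclideanSpace.single i (1 : ℝ) with he
  set D := U.indicator (partialDeriv f i) with hD
  have hφ : ContDiff ℝ 1 (φ.normed volume) := φ.contDiff_normed
  have hφc : HasCompactSupport (φ.normed volume) := φ.hasCompactSupport_normed
  have hφ'c : Continuous fun t => fderiv ℝ (φ.normed volume) t e :=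
    (hφ.continuous_fderiv (by simp)).clm_apply continuous_const
  have hDm : Measurable D := measurable_indicator_partialDeriv hU hf hd
  have hbd : ∀ t, ‖f (x - t)‖ ≤ M := fun t => hM _
  have hfm : AEStronglyMeasurable (fun t => f (x - t)) volume :=
    (hf.comp (measurable_const.sub measurable_id)).aestronglyMeasurable
  have hi1 : Integrable fun t => φ.normed volume t * f (x - t) :=
    (hφ.continuous.integrable_of_hasCompactSupport hφc).mul_bdd hfm (Eventually.of_forall hbd)
  have hi2 : Integrable fun t => fderiv ℝ (φ.normed volume) t e * f (x - t) :=
    (hφ'c.integrable_of_hasCompactSupport ((hφc.fderiv ℝ).comp_left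
      (g := fun L : EuclideanSpace ℝ (Fin n) →L[ℝ] ℝ => L e) (by simp))).mul_bdd hfm
      (Eventually.of_forall hbd)
  have hball : ∀ t ∈ tsupport (φ.normed volume), x - t ∈ Metric.closedBall x φ.rOut := by
    intro t ht
    rw [φ.tsupport_normed_eq] at ht
    simpa using ht
  have hi3 : Integrable fun t => φ.normed volume t * D (x - t) := by
    have hind : Integrable ((Metric.closedBall x φ.rOut).indicator D) :=
      hint.integrable_indicator Metric.isClosed_closedBall.measurableSet
    have h1 : Integrable fun t => (Metric.closedBall x φ.rOut).indicator D (x - t) :=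
      hind.comp_sub_left x
    obtain ⟨K, hK⟩ := hφ.continuous.bounded_above_of_compact_support hφc
    refine (h1.bdd_mul hφ.continuous.aestronglyMeasurable (Eventually.of_forall hK)).congr
      (Eventually.of_forall fun t => ?_)
    by_cases ht : t ∈ tsupport (φ.normed volume)
    · simp only [Set.indicator_of_mem (hball t ht)]
    · simp [image_eq_zero_of_notMem_tsupport ht]
  refine ⟨hi3, ?_⟩
  rw [fderiv_mollify φ hf hM]
  have := integral_bilinear_hasLineDerivAt_right_eq_neg_left_of_integrable
    (μ := (volume : Measure (EuclideanSpace ℝ (Fin n)))) (v := e)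
    (B := ContinuousLinearMap.mul ℝ ℝ) (f := φ.normed volume)
    (f' := fun t => fderiv ℝ (φ.normed volume) t e) (g := fun t => f (x - t))
    (g' := fun t => -D (x - t)) hi2 (by simpa using hi3.neg) hi1
    (fun t _ => ((hφ.differentiable (by simp)) t).hasFDerivAt.hasLineDerivAt e)
    -- The reflection `t ↦ x - t` turns the line derivative of `f` into its negative, by the chain
    -- rule with `s ↦ -s`.
    (fun t ht => by
      have hmem := hx (hball t ht)
      have h := (hd _ hmem).hasLineDerivAt
      rw [hD, Set.indicator_of_mem hmem]
      unfold HasLineDerivAt at h ⊢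
      have h2 : HasDerivAt (fun s : ℝ => -s) (-1) 0 := (hasDerivAt_id (0 : ℝ)).neg
      have h' : HasDerivAt (fun s : ℝ => f (x - t + s • e)) (lineDeriv ℝ f (x - t) e) (-0) := by
        simpa using h
      have h3 := h'.scomp (0 : ℝ) h2
      refine (h3.congr_deriv (by simp [partialDeriv, he])).congr_of_eventuallyEq
        (Eventually.of_forall fun s => ?_)
      simp only [Function.comp]
      congr 1
      module)
  simp only [ContinuousLinearMap.mul_apply', mul_neg, integral_neg, neg_inj] at this
  exact this.symm

/-- Jensen's inequality for the probability measure with density the normalised bump. The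
combination `∑ v i ∂ᵢ f` need not be a directional derivative of `f` itself; linearity in the
direction is used only for the mollified function, which is `C¹`. -/
lemma enorm_fderiv_mollify_sq_le (hf : Measurable f) (hM : ∀ x, ‖f x‖ ≤ M)
    {U : Set (EuclideanSpace ℝ (Fin n))} (hU : MeasurableSet U)
    (hd : ∀ x ∈ U, ∀ i, LineDifferentiableAt ℝ f x (EuclideanSpace.single i (1 : ℝ)))
    {x : EuclideanSpace ℝ (Fin n)} (hx : Metric.closedBall x φ.rOut ⊆ U)
    (hint : ∀ i, IntegrableOn (U.indicator (partialDeriv f i)) (Metric.closedBall x φ.rOut))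
    (v : EuclideanSpace ℝ (Fin n)) :
    ‖fderiv ℝ (mollify φ f) x v‖ₑ ^ 2 ≤ ∫⁻ t, ENNReal.ofReal (φ.normed volume t) *
      ‖∑ i, v i * U.indicator (partialDeriv f i) (x - t)‖ₑ ^ 2 := by
  have hφc : Continuous (φ.normed volume) := (φ.contDiff_normed (n := 0)).continuous
  have hDm : ∀ i, Measurable (U.indicator (partialDeriv f i)) := fun i =>
    measurable_indicator_partialDeriv hU hf fun x hx => hd x hx i
  have hs := fun i => fderiv_mollify_single φ hf hM hU (fun x hx => hd x hx i) hx (hint i)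
  have hv : v = ∑ i, v i • EuclideanSpace.single i (1 : ℝ) := by
    ext j
    simp [Finset.sum_apply, Pi.single_apply]
  have h1 : fderiv ℝ (mollify φ f) x v =
      ∫ t, φ.normed volume t * ∑ i, v i * U.indicator (partialDeriv f i) (x - t) := by
    conv_lhs => rw [hv, map_sum]
    simp only [map_smul, (hs _).2, smul_eq_mul, ← integral_const_mul]
    rw [← integral_finsetSum _ fun i _ => (hs i).1.const_mul _]
    refine integral_congr_ae (Eventually.of_forall fun t => ?_)
    simp only [Finset.mul_sum]
    exact Finset.sum_congr rfl fun i _ => by ring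
  have hw : Measurable fun t => ENNReal.ofReal (φ.normed volume t) :=
    hφc.measurable.ennreal_ofReal
  have hSm : Measurable fun t => ‖∑ i, v i * U.indicator (partialDeriv f i) (x - t)‖ₑ := by
    refine Measurable.enorm (Finset.measurable_sum _ fun i _ => ?_)
    exact ((hDm i).comp (measurable_const.sub measurable_id)).const_mul _
  have hmass : (volume.withDensity fun t => ENNReal.ofReal (φ.normed volume t)) Set.univ = 1 := by
    rw [withDensity_apply _ MeasurableSet.univ, Measure.restrict_univ,
      ← ofReal_integral_eq_lintegral_ofReal φ.integrable_normed
        (Eventually.of_forall φ.nonneg_normed), φ.integral_normed, ENNReal.ofReal_one]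
  rw [h1]
  calc _ ≤ (∫⁻ t, ENNReal.ofReal (φ.normed volume t) *
        ‖∑ i, v i * U.indicator (partialDeriv f i) (x - t)‖ₑ) ^ 2 := by
        gcongr
        refine (enorm_integral_le_lintegral_enorm _).trans (le_of_eq (lintegral_congr fun t => ?_))
        rw [enorm_mul, Real.enorm_of_nonneg (φ.nonneg_normed t)]
    _ = (∫⁻ t, ‖∑ i, v i * U.indicator (partialDeriv f i) (x - t)‖ₑ
        ∂(volume.withDensity fun t => ENNReal.ofReal (φ.normed volume t))) ^ 2 := by
        rw [lintegral_withDensity_eq_lintegral_mul _ hw hSm]; rfl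
    _ ≤ _ := by
        refine (sq_lintegral_le _ hSm.aemeasurable).trans ?_
        rw [hmass, one_mul, lintegral_withDensity_eq_lintegral_mul _ hw (hSm.pow_const 2)]
        rfl

end Mollify

/-- Mollify at radii at most `δ`. Within that distance the weight changes by at most a factor `2`,
so it can be moved under the convolution at that cost; Fubini and translation invariance then leave
the energy of `f`. Almost everywhere convergence holds at Lebesgue points. -/
theorem exists_smooth_approx {f : EuclideanSpace ℝ (Fin n) → ℝ} {M : ℝ}
    (hf : Measurable f) (hM : ∀ x, ‖f x‖ ≤ M)
    {U : Set (EuclideanSpace ℝ (Fin n))} (hU : MeasurableSet U)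
    (hd : ∀ x ∈ U, ∀ i, LineDifferentiableAt ℝ f x (EuclideanSpace.single i (1 : ℝ)))
    {r : EuclideanSpace ℝ (Fin n) → ℝ≥0∞} (hr : Measurable r) (hr0 : ∀ x ∈ U, r x ≠ 0)
    (hrt : ∀ x, r x ≠ ∞)
    (hfin : ∀ i, ∫⁻ x, ‖U.indicator (partialDeriv f i) x‖ₑ ^ 2 * r x ≠ ∞)
    {B : Set (EuclideanSpace ℝ (Fin n))} (hB : MeasurableSet B) {δ : ℝ} (hδ : 0 < δ)
    (hBU : ∀ x ∈ B, ∀ u, dist u x ≤ δ → u ∈ U ∧ r x ≤ 2 * r u) :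
    ∃ g : ℕ → EuclideanSpace ℝ (Fin n) → ℝ, (∀ m, ContDiff ℝ 1 (g m)) ∧
      (∀ᵐ x, Tendsto (fun m => g m x) atTop (𝓝 (f x))) ∧
      ∀ m (v : EuclideanSpace ℝ (Fin n)), ∫⁻ x in B, ‖fderiv ℝ (g m) x v‖ₑ ^ 2 * r x ≤
        2 * ∫⁻ x, ‖∑ i, v i * U.indicator (partialDeriv f i) x‖ₑ ^ 2 * r x := by
  -- The inner radius is half the outer one, since the almost everywhere convergence requires a
  -- bounded ratio of the two radii; it is used with ratio `2`.
  let φ : ℕ → ContDiffBump (0 : EuclideanSpace ℝ (Fin n)) := fun m =>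
    ⟨δ / (m + 1) / 2, δ / (m + 1), by positivity, half_lt_self (by positivity)⟩
  have hrOut : ∀ m, (φ m).rOut = δ / (m + 1) := fun m => rfl
  have hrIn : ∀ m, (φ m).rIn = δ / (m + 1) / 2 := fun m => rfl
  have hle : ∀ m, (φ m).rOut ≤ δ := fun m => by
    rw [hrOut]
    exact div_le_self hδ.le (by linarith [(Nat.cast_nonneg m : (0 : ℝ) ≤ m)])
  refine ⟨fun m => mollify (φ m) f, fun m => contDiff_mollify _ hf hM, ?_, fun m v => ?_⟩
  · refine ContDiffBump.ae_convolution_tendsto_right_of_locallyIntegrable (K := 2) ?_ ?_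
      (locallyIntegrable_of_bounded hf hM)
    · simp only [hrOut]
      have := (tendsto_one_div_add_atTop_nhds_zero_nat (𝕜 := ℝ)).const_mul δ
      simpa [div_eq_mul_inv] using this
    · exact Eventually.of_forall fun m => by rw [hrOut, hrIn]; linarith
  · have hDm : ∀ i, Measurable (U.indicator (partialDeriv f i)) := fun i =>
      measurable_indicator_partialDeriv hU hf fun x hx => hd x hx i
    set G : EuclideanSpace ℝ (Fin n) → ℝ≥0∞ := fun x =>
      ‖∑ i, v i * U.indicator (partialDeriv f i) x‖ₑ ^ 2 with hG
    have hGm : Measurable G :=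
      (Finset.measurable_sum _ fun i _ => (hDm i).const_mul _).enorm.pow_const 2
    have hφm : Measurable fun t => ENNReal.ofReal ((φ m).normed volume t) :=
      ((φ m).contDiff_normed (n := 0)).continuous.measurable.ennreal_ofReal
    have hmass : ∫⁻ t, ENNReal.ofReal ((φ m).normed volume t) = 1 := by
      rw [← ofReal_integral_eq_lintegral_ofReal (φ m).integrable_normed
        (Eventually.of_forall (φ m).nonneg_normed), (φ m).integral_normed, ENNReal.ofReal_one]
    calc ∫⁻ x in B, ‖fderiv ℝ (mollify (φ m) f) x v‖ₑ ^ 2 * r x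
        ≤ ∫⁻ x in B, ∫⁻ t, ENNReal.ofReal ((φ m).normed volume t) *
            (2 * (G (x - t) * r (x - t))) := by
          refine setLIntegral_mono' hB fun x hx => ?_
          have hxU : Metric.closedBall x (φ m).rOut ⊆ U := fun u hu =>
            (hBU x hx u (hu.trans (hle m))).1
          have hxx : x ∈ U := (hBU x hx x (by simpa using hδ.le)).1
          have h := enorm_fderiv_mollify_sq_le (φ m) hf hM hU hd hxU (fun i =>
            integrableOn_of_weight (hDm i) (hfin i) Metric.isClosed_closedBall.measurableSet
              measure_closedBall_lt_top.ne (c := r x / 2)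
              (ENNReal.div_ne_zero.2 ⟨hr0 x hxx, by simp⟩)
              (ENNReal.div_ne_top (hrt x) (by simp)) fun u hu => by
                refine ENNReal.div_le_of_le_mul' ?_
                exact (hBU x hx u (hu.trans (hle m))).2) v
          calc _ ≤ _ := mul_le_mul_left h _
            _ = ∫⁻ t, ENNReal.ofReal ((φ m).normed volume t) * G (x - t) * r x :=
              (lintegral_mul_const' _ _ (hrt x)).symm
            _ ≤ _ := by
              refine lintegral_mono fun t => ?_
              by_cases ht : t ∈ Function.support ((φ m).normed volume)
              · rw [(φ m).support_normed_eq] at ht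
                have h2 := (hBU x hx (x - t) (by
                  have : ‖t‖ ≤ (φ m).rOut := (mem_ball_zero_iff.1 ht).le
                  simpa [dist_eq_norm] using this.trans (hle m))).2
                calc _ ≤ ENNReal.ofReal ((φ m).normed volume t) * G (x - t) * (2 * r (x - t)) := by
                      gcongr
                  _ = _ := by ring
              · simp [Function.notMem_support.1 ht]
      _ ≤ ∫⁻ x, ∫⁻ t, ENNReal.ofReal ((φ m).normed volume t) * (2 * (G (x - t) * r (x - t))) :=
          setLIntegral_le_lintegral _ _
      _ = ∫⁻ t, ∫⁻ x, ENNReal.ofReal ((φ m).normed volume t) * (2 * (G (x - t) * r (x - t))) := by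
          refine lintegral_lintegral_swap (Measurable.aemeasurable ?_)
          have hsub : Measurable fun p : EuclideanSpace ℝ (Fin n) × EuclideanSpace ℝ (Fin n) =>
            p.1 - p.2 := measurable_fst.sub measurable_snd
          exact (hφm.comp measurable_snd).mul
            (((hGm.comp hsub).mul (hr.comp hsub)).const_mul 2)
      _ = ∫⁻ t, ENNReal.ofReal ((φ m).normed volume t) * (2 * ∫⁻ x, G x * r x) := by
          refine lintegral_congr fun t => ?_
          rw [lintegral_const_mul' _ _ ENNReal.ofReal_ne_top, lintegral_const_mul' _ _ (by simp),
            lintegral_sub_right_eq_self fun x => G x * r x]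
      _ = _ := by rw [lintegral_mul_const _ hφm, hmass, one_mul]

/-! ### Active and inactive coordinates -/

section Coordinates

variable {k : ℕ}

/-- The vector with active coordinates `y` and inactive coordinates `z`. -/
def glue (y : EuclideanSpace ℝ (ActiveIdx n k)) (z : EuclideanSpace ℝ (InactiveIdx n k)) :
    EuclideanSpace ℝ (Fin n) :=
  WithLp.toLp 2 fun i => if h : (i : ℕ) < k then y ⟨i, h⟩ else z ⟨i, h⟩

lemma sum_split (F : Fin n → ℝ) :
    ∑ i, F i = ∑ i : ActiveIdx n k, F i + ∑ i : InactiveIdx n k, F i :=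
  (Fintype.sum_subtype_add_sum_subtype (fun i : Fin n => (i : ℕ) < k) F).symm

lemma glue_active (y : EuclideanSpace ℝ (ActiveIdx n k)) (z : EuclideanSpace ℝ (InactiveIdx n k))
    (i : ActiveIdx n k) : glue y z i = y i := by
  simp [glue, i.2]

lemma glue_inactive (y : EuclideanSpace ℝ (ActiveIdx n k))
    (z : EuclideanSpace ℝ (InactiveIdx n k)) (i : InactiveIdx n k) : glue y z i = z i := by
  simp [glue, i.2]

lemma norm_sq_glue (y : EuclideanSpace ℝ (ActiveIdx n k))
    (z : EuclideanSpace ℝ (InactiveIdx n k)) : ‖glue y z‖ ^ 2 = ‖y‖ ^ 2 + ‖z‖ ^ 2 := by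
  simp only [EuclideanSpace.norm_sq_eq]
  rw [sum_split (k := k)]
  simp only [glue_active, glue_inactive]

/-- Gluing is the inverse of splitting a finite product by a predicate, up to the volume-preserving
identification of Euclidean space with the plain product. -/
lemma measurePreserving_glue :
    MeasurePreserving fun p : EuclideanSpace ℝ (ActiveIdx n k) ×
      EuclideanSpace ℝ (InactiveIdx n k) => glue p.1 p.2 := by
  have h1 := (PiLp.volume_preserving_ofLp (ActiveIdx n k)).prod
    (PiLp.volume_preserving_ofLp (InactiveIdx n k))
  have h2 := (volume_preserving_piEquivPiSubtypeProd (fun _ : Fin n => ℝ)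
    (fun i : Fin n => (i : ℕ) < k)).symm
  exact ((PiLp.volume_preserving_toLp (Fin n)).comp h2).comp h1

variable {W : Matrix (Fin n) (Fin n) ℝ}

lemma combine_eq (y : EuclideanSpace ℝ (ActiveIdx n k))
    (z : EuclideanSpace ℝ (InactiveIdx n k)) :
    combine W k y z = Matrix.toEuclideanLin W (glue y z) := by
  ext i
  simp only [combine, PiLp.add_apply, Matrix.toLpLin_apply, Matrix.mulVec, dotProduct,
    activeBlock, inactiveBlock, Matrix.submatrix_apply, id]
  rw [sum_split (k := k)]
  congr 1
  · exact Finset.sum_congr rfl fun j _ => by rw [← glue_active y z j]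
  · exact Finset.sum_congr rfl fun j _ => by rw [← glue_inactive y z j]

lemma toEuclideanLin_transpose_apply (hW : W ∈ Matrix.orthogonalGroup (Fin n) ℝ)
    (x : EuclideanSpace ℝ (Fin n)) :
    Matrix.toEuclideanLin W.transpose (Matrix.toEuclideanLin W x) = x := by
  have h : W.transpose * W = 1 := by
    simpa [Matrix.star_eq_conjTranspose] using (Matrix.mem_unitaryGroup_iff'.1 hW)
  ext i
  simp [Matrix.toLpLin_apply, Matrix.mulVec_mulVec, h]

lemma transpose_mem_orthogonalGroup (hW : W ∈ Matrix.orthogonalGroup (Fin n) ℝ) :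
    W.transpose ∈ Matrix.orthogonalGroup (Fin n) ℝ := by
  have h := Matrix.mem_unitaryGroup_iff'.1 hW
  rw [Matrix.mem_orthogonalGroup_iff]
  simpa [Matrix.star_eq_conjTranspose] using h

lemma norm_toEuclideanLin (hW : W ∈ Matrix.orthogonalGroup (Fin n) ℝ)
    (x : EuclideanSpace ℝ (Fin n)) : ‖Matrix.toEuclideanLin W x‖ = ‖x‖ := by
  have h : W.transpose * W = 1 := by
    simpa [Matrix.star_eq_conjTranspose] using (Matrix.mem_unitaryGroup_iff'.1 hW)
  rw [← sq_eq_sq₀ (norm_nonneg _) (norm_nonneg _), ← real_inner_self_eq_norm_sq,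
    ← real_inner_self_eq_norm_sq]
  simp only [EuclideanSpace.inner_eq_star_dotProduct, Matrix.toLpLin_apply, star_trivial]
  rw [Matrix.dotProduct_mulVec, Matrix.vecMul_mulVec, h, Matrix.vecMul_one]

lemma norm_sq_combine (hW : W ∈ Matrix.orthogonalGroup (Fin n) ℝ)
    (y : EuclideanSpace ℝ (ActiveIdx n k)) (z : EuclideanSpace ℝ (InactiveIdx n k)) :
    ‖combine W k y z‖ ^ 2 = ‖y‖ ^ 2 + ‖z‖ ^ 2 := by
  rw [combine_eq, norm_toEuclideanLin hW, norm_sq_glue]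

lemma measurePreserving_combine (hW : W ∈ Matrix.orthogonalGroup (Fin n) ℝ) :
    MeasurePreserving fun p : EuclideanSpace ℝ (ActiveIdx n k) ×
      EuclideanSpace ℝ (InactiveIdx n k) => combine W k p.1 p.2 := by
  let e : EuclideanSpace ℝ (Fin n) ≃ₗᵢ[ℝ] EuclideanSpace ℝ (Fin n) :=
    LinearIsometry.toLinearIsometryEquiv ⟨Matrix.toEuclideanLin W, norm_toEuclideanLin hW⟩ rfl
  have := e.measurePreserving.comp (measurePreserving_glue (n := n) (k := k))
  simp only [combine_eq]
  exact this

lemma activeVar_combine (hW : W ∈ Matrix.orthogonalGroup (Fin n) ℝ)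
    (y : EuclideanSpace ℝ (ActiveIdx n k)) (z : EuclideanSpace ℝ (InactiveIdx n k)) :
    activeVar W k (combine W k y z) = y := by
  have h := toEuclideanLin_transpose_apply hW (glue y z)
  rw [← combine_eq] at h
  ext i
  rw [← glue_active y z i, ← h]
  rfl

lemma exists_combine (hW : W ∈ Matrix.orthogonalGroup (Fin n) ℝ)
    (x : EuclideanSpace ℝ (Fin n)) :
    ∃ z : EuclideanSpace ℝ (InactiveIdx n k), combine W k (activeVar W k x) z = x := by
  let u := Matrix.toEuclideanLin W.transpose x
  refine ⟨WithLp.toLp 2 fun i => u i, ?_⟩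
  have hu : glue (activeVar W k x) (WithLp.toLp 2 fun i : InactiveIdx n k => u i) = u := by
    ext i
    by_cases h : (i : ℕ) < k
    · exact glue_active _ _ ⟨i, h⟩
    · exact glue_inactive _ _ ⟨i, h⟩
  rw [combine_eq, hu]
  have := toEuclideanLin_transpose_apply (transpose_mem_orthogonalGroup hW) x
  rwa [Matrix.transpose_transpose] at this

lemma continuous_combine : Continuous fun p : EuclideanSpace ℝ (ActiveIdx n k) ×
    EuclideanSpace ℝ (InactiveIdx n k) => combine W k p.1 p.2 := by
  unfold combine
  exact ((LinearMap.continuous_of_finiteDimensional _).comp continuous_fst).add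
    ((LinearMap.continuous_of_finiteDimensional _).comp continuous_snd)

lemma continuous_activeVar : Continuous (activeVar W k) :=
  LinearMap.continuous_of_finiteDimensional _

lemma measurable_combine : Measurable fun p : EuclideanSpace ℝ (ActiveIdx n k) ×
    EuclideanSpace ℝ (InactiveIdx n k) => combine W k p.1 p.2 :=
  continuous_combine.measurable

lemma lintegral_eq_lintegral_combine (hW : W ∈ Matrix.orthogonalGroup (Fin n) ℝ)
    {F : EuclideanSpace ℝ (Fin n) → ℝ≥0∞} (hF : Measurable F) :
    ∫⁻ x, F x = ∫⁻ (y : EuclideanSpace ℝ (ActiveIdx n k)),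
      ∫⁻ (z : EuclideanSpace ℝ (InactiveIdx n k)), F (combine W k y z) := by
  rw [← (measurePreserving_combine (k := k) hW).lintegral_comp hF]
  exact lintegral_prod (fun p : EuclideanSpace ℝ (ActiveIdx n k) ×
    EuclideanSpace ℝ (InactiveIdx n k) => F (combine W k p.1 p.2))
    (hF.comp measurable_combine).aemeasurable

/-- The column `w_j` of `W`. -/
def column (W : Matrix (Fin n) (Fin n) ℝ) (j : Fin n) : EuclideanSpace ℝ (Fin n) :=
  WithLp.toLp 2 fun i => W i j

lemma hasFDerivAt_combine (y : EuclideanSpace ℝ (ActiveIdx n k))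
    (z : EuclideanSpace ℝ (InactiveIdx n k)) : HasFDerivAt (combine W k y)
      (LinearMap.toContinuousLinearMap (Matrix.toEuclideanLin (inactiveBlock W k))) z :=
  (LinearMap.toContinuousLinearMap (Matrix.toEuclideanLin (inactiveBlock W k))).hasFDerivAt.const_add
    (Matrix.toEuclideanLin (activeBlock W k) y)

lemma contDiff_combine (y : EuclideanSpace ℝ (ActiveIdx n k)) :
    ContDiff ℝ 1 (combine W k y) :=
  contDiff_const.add
    (LinearMap.toContinuousLinearMap (Matrix.toEuclideanLin (inactiveBlock W k))).contDiff

/-- Expand a vector in the standard basis and apply Cauchy–Schwarz. -/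
lemma enorm_sq_le_sum {ι : Type*} [Fintype ι] [DecidableEq ι] (L : EuclideanSpace ℝ ι →L[ℝ] ℝ) :
    ‖L‖ₑ ^ 2 ≤ ∑ j, ‖L (EuclideanSpace.single j (1 : ℝ))‖ₑ ^ 2 := by
  have h : ‖L‖ ≤ √(∑ j, ‖L (EuclideanSpace.single j (1 : ℝ))‖ ^ 2) := by
    refine L.opNorm_le_bound (Real.sqrt_nonneg _) fun v => ?_
    have hv : v = ∑ i, v i • EuclideanSpace.single i (1 : ℝ) := by
      ext j
      simp [Finset.sum_apply, Pi.single_apply]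
    conv_lhs => rw [hv, map_sum]
    simp only [map_smul, smul_eq_mul]
    rw [EuclideanSpace.norm_eq v, Real.norm_eq_abs]
    refine Real.abs_le_sqrt ?_ |>.trans (Real.sqrt_mul (by positivity) _).le
    rw [mul_comm]
    simpa only [Real.norm_eq_abs, sq_abs] using Finset.sum_mul_sq_le_sq_mul_sq Finset.univ
      (fun i => v i) (fun i => L (EuclideanSpace.single i (1 : ℝ)))
  have h2 : ‖L‖ ^ 2 ≤ ∑ j, ‖L (EuclideanSpace.single j (1 : ℝ))‖ ^ 2 := by
    rw [← Real.sq_sqrt (show 0 ≤ ∑ j, ‖L (EuclideanSpace.single j (1 : ℝ))‖ ^ 2 by positivity)]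
    exact pow_le_pow_left₀ (norm_nonneg _) h 2
  simp only [← ofReal_norm, ← ENNReal.ofReal_pow (norm_nonneg _)]
  rw [← ENNReal.ofReal_sum_of_nonneg fun i _ => by positivity]
  exact ENNReal.ofReal_le_ofReal h2

/-- By the chain rule, the derivative of the slice function along a coordinate of `z` is the
derivative of `g` along the corresponding inactive column of `W`. -/
lemma enorm_fderiv_comp_combine_sq_le {g : EuclideanSpace ℝ (Fin n) → ℝ} (hg : ContDiff ℝ 1 g)
    (y : EuclideanSpace ℝ (ActiveIdx n k)) (z : EuclideanSpace ℝ (InactiveIdx n k)) :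
    ‖fderiv ℝ (fun z => g (combine W k y z)) z‖ₑ ^ 2 ≤
      ∑ j : InactiveIdx n k, ‖fderiv ℝ g (combine W k y z) (column W j)‖ₑ ^ 2 := by
  have h := ((hg.differentiable (by simp)) (combine W k y z)).hasFDerivAt.comp z
    (hasFDerivAt_combine (W := W) y z)
  rw [show fderiv ℝ (fun z => g (combine W k y z)) z = _ from h.fderiv]
  refine (enorm_sq_le_sum _).trans (le_of_eq (Finset.sum_congr rfl fun j _ => ?_))
  have hc : Matrix.toEuclideanLin (inactiveBlock W k) (EuclideanSpace.single j (1 : ℝ)) =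
      column W j := by
    ext i
    simp [Matrix.toLpLin_apply, inactiveBlock, column]
  simp [hc]

end Coordinates

/-! ### The conditional Poincaré inequality -/

section Slices

variable {k : ℕ} {ρ : EuclideanSpace ℝ (Fin n) → ℝ} {W : Matrix (Fin n) (Fin n) ℝ}

/-- The space of triples `(y, (z, z'))`. -/
abbrev PairSpace (n k : ℕ) : Type := EuclideanSpace ℝ (ActiveIdx n k) ×
  (EuclideanSpace ℝ (InactiveIdx n k) × EuclideanSpace ℝ (InactiveIdx n k))

/-- The joint density of `(Y, Z, Z')`, where `Z` and `Z'` are conditionally independent given `Y`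
and both have the conditional distribution. -/
def pairDensity (ρ : EuclideanSpace ℝ (Fin n) → ℝ) (W : Matrix (Fin n) (Fin n) ℝ) (k : ℕ)
    (y : EuclideanSpace ℝ (ActiveIdx n k))
    (p : EuclideanSpace ℝ (InactiveIdx n k) × EuclideanSpace ℝ (InactiveIdx n k)) : ℝ≥0∞ :=
  ENNReal.ofReal (marginalDensity ρ W k y) *
    (ENNReal.ofReal (condDensity ρ W k y p.1) * ENNReal.ofReal (condDensity ρ W k y p.2))

/-- The part of a set `A` in the slice through `y`. -/
def slice (W : Matrix (Fin n) (Fin n) ℝ) (A : Set (EuclideanSpace ℝ (Fin n)))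
    (y : EuclideanSpace ℝ (ActiveIdx n k)) : Set (EuclideanSpace ℝ (InactiveIdx n k)) :=
  combine W k y ⁻¹' A

lemma measurable_combine_right (y : EuclideanSpace ℝ (ActiveIdx n k)) :
    Measurable (combine W k y) :=
  (contDiff_combine y).continuous.measurable

lemma measurableSet_slice {A : Set (EuclideanSpace ℝ (Fin n))} (hA : MeasurableSet A)
    (y : EuclideanSpace ℝ (ActiveIdx n k)) : MeasurableSet (slice W A y) :=
  measurable_combine_right y hA

/-- A Poincaré inequality for smooth functions on the slices of `A`, with gradients on `B`. -/
def SliceInequality (ρ : EuclideanSpace ℝ (Fin n) → ℝ) (A B : Set (EuclideanSpace ℝ (Fin n)))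
    (K : ℝ≥0∞) (W : Matrix (Fin n) (Fin n) ℝ) (k : ℕ) : Prop :=
  ∀ g : EuclideanSpace ℝ (Fin n) → ℝ, ContDiff ℝ 1 g → ∀ y ∈ activeDomain ρ W k,
    ∫⁻ p in slice W A y ×ˢ slice W A y,
        ‖g (combine W k y p.1) - g (combine W k y p.2)‖ₑ ^ 2 * pairDensity ρ W k y p ≤
      K * ∫⁻ z in slice W B y, ‖fderiv ℝ (fun z => g (combine W k y z)) z‖ₑ ^ 2 *
        ENNReal.ofReal (ρ (combine W k y z))

lemma marginalDensity_eq_zero (hρ : ∀ x, 0 ≤ ρ x) (hW : W ∈ Matrix.orthogonalGroup (Fin n) ℝ)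
    {y : EuclideanSpace ℝ (ActiveIdx n k)} (hy : y ∉ activeDomain ρ W k) :
    marginalDensity ρ W k y = 0 := by
  have h : ∀ z, ρ (combine W k y z) = 0 := fun z => by
    by_contra hne
    exact hy ⟨combine W k y z, lt_of_le_of_ne (hρ _) (Ne.symm hne), activeVar_combine hW y z⟩
  simp [marginalDensity, h]

lemma measurable_marginalDensity (hρ : Measurable ρ) : Measurable (marginalDensity ρ W k) := by
  have h : StronglyMeasurable fun p : EuclideanSpace ℝ (ActiveIdx n k) ×
      EuclideanSpace ℝ (InactiveIdx n k) => ρ (combine W k p.1 p.2) :=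
    (hρ.comp measurable_combine).stronglyMeasurable
  exact h.integral_prod_right'.measurable

lemma measurable_condDensity (hρ : Measurable ρ) :
    Measurable fun p : EuclideanSpace ℝ (ActiveIdx n k) × EuclideanSpace ℝ (InactiveIdx n k) =>
      condDensity ρ W k p.1 p.2 :=
  (hρ.comp measurable_combine).div ((measurable_marginalDensity hρ).comp measurable_fst)

lemma measurable_pairDensity (hρ : Measurable ρ) :
    Measurable fun q : PairSpace n k => pairDensity ρ W k q.1 q.2 := by
  have h := measurable_condDensity (W := W) (k := k) hρ
  have h1 : Measurable fun q : PairSpace n k => ENNReal.ofReal (condDensity ρ W k q.1 q.2.1) :=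
    (h.comp (measurable_fst.prodMk (measurable_fst.comp measurable_snd))).ennreal_ofReal
  have h2 : Measurable fun q : PairSpace n k => ENNReal.ofReal (condDensity ρ W k q.1 q.2.2) :=
    (h.comp (measurable_fst.prodMk (measurable_snd.comp measurable_snd))).ennreal_ofReal
  exact ((measurable_marginalDensity hρ).comp measurable_fst).ennreal_ofReal.mul (h1.mul h2)

lemma measurable_combine_fst : Measurable fun q : PairSpace n k => combine W k q.1 q.2.1 :=
  (measurable_combine (W := W)).comp
    (g := fun p : EuclideanSpace ℝ (ActiveIdx n k) × EuclideanSpace ℝ (InactiveIdx n k) =>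
      combine W k p.1 p.2)
    (f := fun q : PairSpace n k => (q.1, q.2.1))
    (measurable_fst.prodMk (measurable_fst.comp measurable_snd))

lemma measurable_combine_snd : Measurable fun q : PairSpace n k => combine W k q.1 q.2.2 :=
  (measurable_combine (W := W)).comp
    (g := fun p : EuclideanSpace ℝ (ActiveIdx n k) × EuclideanSpace ℝ (InactiveIdx n k) =>
      combine W k p.1 p.2)
    (f := fun q : PairSpace n k => (q.1, q.2.2))
    (measurable_fst.prodMk (measurable_snd.comp measurable_snd))

/-- The pairs of points in a common slice of `A`. -/
def pairSet (W : Matrix (Fin n) (Fin n) ℝ) (k : ℕ) (A : Set (EuclideanSpace ℝ (Fin n))) :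
    Set (PairSpace n k) :=
  {q | combine W k q.1 q.2.1 ∈ A ∧ combine W k q.1 q.2.2 ∈ A}

lemma measurableSet_pairSet {A : Set (EuclideanSpace ℝ (Fin n))} (hA : MeasurableSet A) :
    MeasurableSet (pairSet W k A) :=
  (measurable_combine_fst hA).inter (measurable_combine_snd hA)

/-- The weighted squared difference of the values of `g` at the two points of a pair. -/
def pairDiff (ρ : EuclideanSpace ℝ (Fin n) → ℝ) (W : Matrix (Fin n) (Fin n) ℝ) (k : ℕ)
    (g : EuclideanSpace ℝ (Fin n) → ℝ) (q : PairSpace n k) : ℝ≥0∞ :=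
  ‖g (combine W k q.1 q.2.1) - g (combine W k q.1 q.2.2)‖ₑ ^ 2 * pairDensity ρ W k q.1 q.2

lemma measurable_pairDiff (hρ : Measurable ρ) {g : EuclideanSpace ℝ (Fin n) → ℝ}
    (hg : Measurable g) : Measurable (pairDiff ρ W k g) := by
  have h : Measurable fun q : PairSpace n k =>
      g (combine W k q.1 q.2.1) - g (combine W k q.1 q.2.2) :=
    (hg.comp measurable_combine_fst).sub (hg.comp measurable_combine_snd)
  exact (h.enorm.pow_const 2).mul (measurable_pairDensity hρ)

/-- Integrate the slice inequality over `y` and reassemble the right-hand side by Fubini in the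
rotated coordinates. Off the active domain the marginal density, and with it the left-hand
integrand, vanishes. -/
lemma lintegral_pairs_le_of_sliceInequality (hρ : Measurable ρ) (hρ0 : ∀ x, 0 ≤ ρ x)
    (hW : W ∈ Matrix.orthogonalGroup (Fin n) ℝ) {A B : Set (EuclideanSpace ℝ (Fin n))}
    (hA : MeasurableSet A) (hB : MeasurableSet B) {K : ℝ≥0∞} (hK : K ≠ ∞)
    (hS : SliceInequality ρ A B K W k) {g : EuclideanSpace ℝ (Fin n) → ℝ} (hg : ContDiff ℝ 1 g) :
    ∫⁻ q in pairSet W k A, pairDiff ρ W k g q ≤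
    K * ∑ j : InactiveIdx n k, ∫⁻ x in B, ‖fderiv ℝ g x (column W j)‖ₑ ^ 2 *
      ENNReal.ofReal (ρ x) := by
  have hm : Measurable ((pairSet W k A).indicator (pairDiff ρ W k g)) :=
    (measurable_pairDiff hρ hg.continuous.measurable).indicator (measurableSet_pairSet hA)
  have hDm : ∀ j, Measurable fun x => ‖fderiv ℝ g x (column W j)‖ₑ ^ 2 * ENNReal.ofReal (ρ x) :=
    fun j => ((((hg.continuous_fderiv (by simp)).clm_apply
      continuous_const).measurable.enorm).pow_const 2).mul hρ.ennreal_ofReal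
  set F : EuclideanSpace ℝ (Fin n) → ℝ≥0∞ := B.indicator fun x =>
    ∑ j : InactiveIdx n k, ‖fderiv ℝ g x (column W j)‖ₑ ^ 2 * ENNReal.ofReal (ρ x) with hF
  have hsum : Measurable fun x =>
      ∑ j : InactiveIdx n k, ‖fderiv ℝ g x (column W j)‖ₑ ^ 2 * ENNReal.ofReal (ρ x) :=
    Finset.measurable_sum _ fun j _ => hDm j
  have hFm : Measurable F := hsum.indicator hB
  rw [← lintegral_indicator (measurableSet_pairSet hA), Measure.volume_eq_prod,
    lintegral_prod _ hm.aemeasurable]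
  calc _ ≤ ∫⁻ y : EuclideanSpace ℝ (ActiveIdx n k), K * ∫⁻ z, F (combine W k y z) := by
        refine lintegral_mono fun y => ?_
        by_cases hy : y ∈ activeDomain ρ W k
        · have h := hS g hg y hy
          rw [← lintegral_indicator ((measurableSet_slice hA y).prod (measurableSet_slice hA y))]
            at h
          refine (show _ ≤ _ from h).trans ?_
          rw [← lintegral_indicator (measurableSet_slice hB y)]
          refine mul_le_mul' le_rfl (lintegral_mono fun z => ?_)
          by_cases hz : combine W k y z ∈ B
          · rw [hF, Set.indicator_of_mem hz, Set.indicator_of_mem (show z ∈ slice W B y from hz),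
              ← Finset.sum_mul]
            exact mul_le_mul_left (enorm_fderiv_comp_combine_sq_le hg y z) _
          · rw [Set.indicator_of_notMem (show z ∉ slice W B y from hz)]
            exact zero_le
        · have h : ∀ p, (pairSet W k A).indicator (pairDiff ρ W k g) (y, p) = 0 := fun p => by
            refine Set.indicator_apply_eq_zero.2 fun _ => ?_
            simp [pairDiff, pairDensity, marginalDensity_eq_zero hρ0 hW hy]
          simp only [h, lintegral_zero, zero_le]
    _ = K * ∫⁻ x, F x := by
        rw [lintegral_const_mul' _ _ hK, lintegral_eq_lintegral_combine hW hFm]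
    _ = _ := by
        rw [hF, lintegral_indicator hB,
          lintegral_finsetSum _ fun (j : InactiveIdx n k) _ => hDm j]

end Slices

/-! ### From slices of an exhaustion to the full domain -/

section Exhaustion

variable {k : ℕ} {ρ : EuclideanSpace ℝ (Fin n) → ℝ} {W : Matrix (Fin n) (Fin n) ℝ}

/-- An exhaustion `A m` of the domain of `ρ`, with sets `B m` having room `δ m` in the domain on
which `ρ` oscillates at most by a factor `2`. -/
structure IsExhaustion (ρ : EuclideanSpace ℝ (Fin n) → ℝ)
    (A B : ℕ → Set (EuclideanSpace ℝ (Fin n))) (δ : ℕ → ℝ) : Prop where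
  measurable_left : ∀ m, MeasurableSet (A m)
  measurable_right : ∀ m, MeasurableSet (B m)
  pos : ∀ m, 0 < δ m
  near : ∀ m, ∀ x ∈ B m, ∀ u, dist u x ≤ δ m →
    u ∈ domain ρ ∧ ENNReal.ofReal (ρ x) ≤ 2 * ENNReal.ofReal (ρ u)
  eventually_mem : ∀ x ∈ domain ρ, ∀ᶠ m in atTop, x ∈ A m

/-- The averaged squared length of the inactive part of the gradient of `f`. -/
def inactiveEnergy (ρ : EuclideanSpace ℝ (Fin n) → ℝ) (W : Matrix (Fin n) (Fin n) ℝ) (k : ℕ)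
    (f : EuclideanSpace ℝ (Fin n) → ℝ) : ℝ≥0∞ :=
  ∑ j : InactiveIdx n k, ∫⁻ x, ‖∑ i, W i j * (domain ρ).indicator (partialDeriv f i) x‖ₑ ^ 2 *
    ENNReal.ofReal (ρ x)

/-- Mollifications converge only almost everywhere on `ℝⁿ`; this makes the exceptional null set pull
back to a null set of triples. -/
lemma quasiMeasurePreserving_combine_fst (hW : W ∈ Matrix.orthogonalGroup (Fin n) ℝ) :
    Measure.QuasiMeasurePreserving (fun q : PairSpace n k => combine W k q.1 q.2.1) := by
  have h : Measure.QuasiMeasurePreserving (fun q : PairSpace n k => (q.1, q.2.1)) :=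
    QuasiMeasurePreserving.prodMap (Measure.QuasiMeasurePreserving.id _)
      Measure.quasiMeasurePreserving_fst
  exact (measurePreserving_combine (k := k) hW).quasiMeasurePreserving.comp
    (g := fun p : EuclideanSpace ℝ (ActiveIdx n k) × EuclideanSpace ℝ (InactiveIdx n k) =>
      combine W k p.1 p.2) (f := fun q : PairSpace n k => (q.1, q.2.1)) h

lemma quasiMeasurePreserving_combine_snd (hW : W ∈ Matrix.orthogonalGroup (Fin n) ℝ) :
    Measure.QuasiMeasurePreserving (fun q : PairSpace n k => combine W k q.1 q.2.2) := by
  have h : Measure.QuasiMeasurePreserving (fun q : PairSpace n k => (q.1, q.2.2)) :=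
    QuasiMeasurePreserving.prodMap (Measure.QuasiMeasurePreserving.id _)
      Measure.quasiMeasurePreserving_snd
  exact (measurePreserving_combine (k := k) hW).quasiMeasurePreserving.comp
    (g := fun p : EuclideanSpace ℝ (ActiveIdx n k) × EuclideanSpace ℝ (InactiveIdx n k) =>
      combine W k p.1 p.2) (f := fun q : PairSpace n k => (q.1, q.2.2)) h

lemma tendsto_pairDiff {g : ℕ → EuclideanSpace ℝ (Fin n) → ℝ} {f : EuclideanSpace ℝ (Fin n) → ℝ}
    {q : PairSpace n k}
    (h1 : Tendsto (fun m => g m (combine W k q.1 q.2.1)) atTop (𝓝 (f (combine W k q.1 q.2.1))))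
    (h2 : Tendsto (fun m => g m (combine W k q.1 q.2.2)) atTop (𝓝 (f (combine W k q.1 q.2.2)))) :
    Tendsto (fun m => pairDiff ρ W k (g m) q) atTop (𝓝 (pairDiff ρ W k f q)) := by
  refine ENNReal.Tendsto.mul_const (ENNReal.Tendsto.pow (h1.sub h2).enorm) (Or.inr ?_)
  unfold pairDensity
  finiteness

/-- The index `m` of the exhaustion is fixed, so there is room `δ m` for mollifying. The smooth
inequality passes to the limit by Fatou, its right-hand side being uniformly bounded at the price of
the factor `2`. -/
lemma lintegral_pairDiff_le_of_bounded (hρ : Measurable ρ) (hρ0 : ∀ x, 0 ≤ ρ x)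
    (hW : W ∈ Matrix.orthogonalGroup (Fin n) ℝ) {A B : ℕ → Set (EuclideanSpace ℝ (Fin n))}
    {δ : ℕ → ℝ} (hAB : IsExhaustion ρ A B δ) {K : ℝ≥0∞} (hK : K ≠ ∞) {m : ℕ}
    (hS : SliceInequality ρ (A m) (B m) K W k)
    {f : EuclideanSpace ℝ (Fin n) → ℝ} (hf : Measurable f) {M : ℝ} (hM : ∀ x, ‖f x‖ ≤ M)
    (hd : ∀ x ∈ domain ρ, ∀ i, LineDifferentiableAt ℝ f x (EuclideanSpace.single i (1 : ℝ)))
    (hfin : ∀ i, ∫⁻ x, ‖(domain ρ).indicator (partialDeriv f i) x‖ₑ ^ 2 *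
      ENNReal.ofReal (ρ x) ≠ ∞) :
    ∫⁻ q in pairSet W k (A m), pairDiff ρ W k f q ≤ K * (2 * inactiveEnergy ρ W k f) := by
  have hU : MeasurableSet (domain ρ) := measurableSet_lt measurable_const hρ
  obtain ⟨g, hg, hlim, hen⟩ := exists_smooth_approx hf hM hU hd hρ.ennreal_ofReal
    (fun x hx => (ENNReal.ofReal_pos.2 hx).ne') (fun x => ENNReal.ofReal_ne_top) hfin
    (hAB.measurable_right m) (hAB.pos m) (hAB.near m)
  have hbound : ∀ l, ∫⁻ q in pairSet W k (A m), pairDiff ρ W k (g l) q ≤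
      K * (2 * inactiveEnergy ρ W k f) := fun l => by
    refine (lintegral_pairs_le_of_sliceInequality hρ hρ0 hW (hAB.measurable_left m)
      (hAB.measurable_right m) hK hS (hg l)).trans ?_
    refine mul_le_mul' le_rfl ?_
    rw [inactiveEnergy, Finset.mul_sum]
    exact Finset.sum_le_sum fun (j : InactiveIdx n k) _ => hen l (column W j)
  have hae : ∀ᵐ q : PairSpace n k, Tendsto (fun l => pairDiff ρ W k (g l) q) atTop
      (𝓝 (pairDiff ρ W k f q)) := by
    filter_upwards [(quasiMeasurePreserving_combine_fst (k := k) hW).ae hlim,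
      (quasiMeasurePreserving_combine_snd (k := k) hW).ae hlim] with q h1 h2
    exact tendsto_pairDiff h1 h2
  calc ∫⁻ q in pairSet W k (A m), pairDiff ρ W k f q
      = ∫⁻ q in pairSet W k (A m), liminf (fun l => pairDiff ρ W k (g l) q) atTop := by
        refine lintegral_congr_ae (ae_restrict_of_ae ?_)
        filter_upwards [hae] with q hq using hq.liminf_eq.symm
    _ ≤ liminf (fun l => ∫⁻ q in pairSet W k (A m), pairDiff ρ W k (g l) q) atTop :=
        lintegral_liminf_le fun l => measurable_pairDiff hρ (hg l).continuous.measurable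
    _ ≤ _ := liminf_le_of_le (by isBoundedDefault) fun b hb => by
        obtain ⟨l, hl⟩ := hb.exists
        exact hl.trans (hbound l)

/-- A bounded smooth truncation of `f`. -/
def sinTrunc (m : ℕ) (f : EuclideanSpace ℝ (Fin n) → ℝ) (x : EuclideanSpace ℝ (Fin n)) : ℝ :=
  ((m : ℝ) + 1) * Real.sin (f x / ((m : ℝ) + 1))

/-- The truncations are difference quotients at `0` of `t ↦ sin (t f(x))`, with `t = 1 / (m + 1)`.
-/
lemma tendsto_sinTrunc (f : EuclideanSpace ℝ (Fin n) → ℝ) (x : EuclideanSpace ℝ (Fin n)) :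
    Tendsto (fun m => sinTrunc m f x) atTop (𝓝 (f x)) := by
  have hseq : Tendsto (fun m : ℕ => 1 / ((m : ℝ) + 1)) atTop (𝓝[≠] 0) :=
    tendsto_nhdsWithin_iff.2 ⟨tendsto_one_div_add_atTop_nhds_zero_nat,
      Eventually.of_forall fun m => by simp; positivity⟩
  have h : HasDerivAt (fun t : ℝ => Real.sin (t * f x)) (f x) 0 := by
    simpa using ((hasDerivAt_id (0 : ℝ)).mul_const (f x)).sin
  refine ((hasDerivAt_iff_tendsto_slope_zero.1 h).comp hseq).congr fun m => ?_
  simp [sinTrunc, div_eq_inv_mul]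

/-- The reason for a sine instead of clipping: partial derivatives persist at every point, and they
are only multiplied by a cosine, so the energy does not increase. -/
lemma hasLineDerivAt_sinTrunc {f : EuclideanSpace ℝ (Fin n) → ℝ} {x v : EuclideanSpace ℝ (Fin n)}
    (h : LineDifferentiableAt ℝ f x v) (m : ℕ) :
    HasLineDerivAt ℝ (sinTrunc m f) (Real.cos (f x / ((m : ℝ) + 1)) * lineDeriv ℝ f x v) x v := by
  have h1 := ((h.hasLineDerivAt.div_const ((m : ℝ) + 1)).sin).const_mul ((m : ℝ) + 1)
  have h2 : (m : ℝ) + 1 ≠ 0 := by positivity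
  refine h1.congr_deriv ?_
  simp only [zero_smul, add_zero]
  field_simp

lemma inactiveEnergy_mono {f g : EuclideanSpace ℝ (Fin n) → ℝ}
    {c : EuclideanSpace ℝ (Fin n) → ℝ} (hc : ∀ x, |c x| ≤ 1)
    (h : ∀ x ∈ domain ρ, ∀ i, partialDeriv g i x = c x * partialDeriv f i x) :
    inactiveEnergy ρ W k g ≤ inactiveEnergy ρ W k f := by
  unfold inactiveEnergy
  gcongr with j _ x
  by_cases hx : x ∈ domain ρ
  · simp only [Set.indicator_of_mem hx, h x hx]
    have e : ∑ i, W i j * (c x * partialDeriv f i x) = c x * ∑ i, W i j * partialDeriv f i x := by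
      rw [Finset.mul_sum]
      exact Finset.sum_congr rfl fun i _ => by ring
    rw [e, enorm_mul]
    refine mul_le_of_le_one_left' ?_
    rw [← ofReal_norm, Real.norm_eq_abs]
    exact ENNReal.ofReal_le_one.2 (hc x)
  · simp [Set.indicator_of_notMem hx]

lemma pos_of_pairDensity_ne_zero (hρ0 : ∀ x, 0 ≤ ρ x) {q : PairSpace n k}
    (h : pairDensity ρ W k q.1 q.2 ≠ 0) :
    combine W k q.1 q.2.1 ∈ domain ρ ∧ combine W k q.1 q.2.2 ∈ domain ρ := by
  simp only [pairDensity, condDensity, ne_eq, mul_eq_zero, not_or] at h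
  constructor
  · refine lt_of_le_of_ne (hρ0 _) fun h0 => h.2.1 ?_
    simp [← h0]
  · refine lt_of_le_of_ne (hρ0 _) fun h0 => h.2.2 ?_
    simp [← h0]

/-- A second application of Fatou, in which the level of truncation and the set of the exhaustion
grow together. -/
theorem lintegral_pairDiff_le (hρ : Measurable ρ) (hρ0 : ∀ x, 0 ≤ ρ x)
    (hW : W ∈ Matrix.orthogonalGroup (Fin n) ℝ) {A B : ℕ → Set (EuclideanSpace ℝ (Fin n))}
    {δ : ℕ → ℝ} (hAB : IsExhaustion ρ A B δ) {K : ℝ≥0∞} (hK : K ≠ ∞)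
    (hS : ∀ m, SliceInequality ρ (A m) (B m) K W k)
    {f : EuclideanSpace ℝ (Fin n) → ℝ} (hf : Measurable f)
    (hd : ∀ x ∈ domain ρ, ∀ i, LineDifferentiableAt ℝ f x (EuclideanSpace.single i (1 : ℝ)))
    (hfin : ∀ i, ∫⁻ x, ‖(domain ρ).indicator (partialDeriv f i) x‖ₑ ^ 2 *
      ENNReal.ofReal (ρ x) ≠ ∞) :
    ∫⁻ q, pairDiff ρ W k f q ≤ K * (2 * inactiveEnergy ρ W k f) := by
  have hfm : ∀ m, Measurable (sinTrunc m f) := fun m =>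
    (Real.measurable_sin.comp (hf.div_const _)).const_mul _
  have hpd : ∀ m, ∀ x ∈ domain ρ, ∀ i, partialDeriv (sinTrunc m f) i x =
      Real.cos (f x / ((m : ℝ) + 1)) * partialDeriv f i x := fun m x hx i =>
    (hasLineDerivAt_sinTrunc (hd x hx i) m).lineDeriv
  have hbound : ∀ m, ∫⁻ q in pairSet W k (A m), pairDiff ρ W k (sinTrunc m f) q ≤
      K * (2 * inactiveEnergy ρ W k f) := fun m => by
    refine (lintegral_pairDiff_le_of_bounded (M := (m : ℝ) + 1) hρ hρ0 hW hAB hK (hS m) (hfm m)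
      (fun x => ?_) (fun x hx i => (hasLineDerivAt_sinTrunc (hd x hx i) m).lineDifferentiableAt)
      fun i => ?_).trans ?_
    · rw [sinTrunc, norm_mul, Real.norm_of_nonneg (by positivity)]
      exact mul_le_of_le_one_right (by positivity) (Real.abs_sin_le_one _)
    · refine ne_top_of_le_ne_top (hfin i) (lintegral_mono fun x => ?_)
      by_cases hx : x ∈ domain ρ
      · simp only [Set.indicator_of_mem hx, hpd m x hx, enorm_mul]
        gcongr
        refine mul_le_of_le_one_left' ?_
        rw [← ofReal_norm, Real.norm_eq_abs]
        exact ENNReal.ofReal_le_one.2 (Real.abs_cos_le_one _)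
      · simp [Set.indicator_of_notMem hx]
    · gcongr
      exact inactiveEnergy_mono (fun x => Real.abs_cos_le_one _) (hpd m)
  have hlim : ∀ q : PairSpace n k, pairDiff ρ W k f q ≤
      liminf (fun m => (pairSet W k (A m)).indicator (pairDiff ρ W k (sinTrunc m f)) q)
        atTop := by
    intro q
    -- Where the pair density is nonzero, both points lie in the domain, hence in `A m` for all
    -- large `m`, and the indicator is eventually inactive.
    by_cases h0 : pairDensity ρ W k q.1 q.2 = 0
    · simp [pairDiff, h0]
    · obtain ⟨h1, h2⟩ := pos_of_pairDensity_ne_zero hρ0 h0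
      have ht := tendsto_pairDiff (ρ := ρ) (W := W) (q := q)
        (tendsto_sinTrunc f (combine W k q.1 q.2.1)) (tendsto_sinTrunc f (combine W k q.1 q.2.2))
      refine (ht.congr' ?_).liminf_eq.ge
      filter_upwards [hAB.eventually_mem _ h1, hAB.eventually_mem _ h2] with m hm1 hm2
      exact (Set.indicator_of_mem (show q ∈ pairSet W k (A m) from ⟨hm1, hm2⟩) _).symm
  calc ∫⁻ q, pairDiff ρ W k f q
      ≤ ∫⁻ q, liminf (fun m => (pairSet W k (A m)).indicator
          (pairDiff ρ W k (sinTrunc m f)) q) atTop := lintegral_mono hlim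
    _ ≤ liminf (fun m => ∫⁻ q, (pairSet W k (A m)).indicator
          (pairDiff ρ W k (sinTrunc m f)) q) atTop :=
        lintegral_liminf_le fun m => (measurable_pairDiff hρ (hfm m)).indicator
          (measurableSet_pairSet (hAB.measurable_left m))
    _ ≤ _ := liminf_le_of_le (by isBoundedDefault) fun b hb => by
        obtain ⟨m, hm⟩ := hb.exists
        rw [lintegral_indicator (measurableSet_pairSet (hAB.measurable_left m))] at hm
        exact hm.trans (hbound m)

end Exhaustion

/-! ### Uniform distributions on convex sets -/

section Uniform

variable {k : ℕ} {W : Matrix (Fin n) (Fin n) ℝ} {S : Set (EuclideanSpace ℝ (Fin n))}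

lemma combine_convexCombination {a b : ℝ} (hab : a + b = 1)
    (y : EuclideanSpace ℝ (ActiveIdx n k)) (z z' : EuclideanSpace ℝ (InactiveIdx n k)) :
    combine W k y (a • z + b • z') = a • combine W k y z + b • combine W k y z' := by
  obtain rfl : b = 1 - a := by linarith
  simp only [combine, map_add, map_smul]
  module

lemma convex_slice (hS : Convex ℝ S) (y : EuclideanSpace ℝ (ActiveIdx n k)) :
    Convex ℝ (slice W S y) := by
  intro z hz z' hz' a b ha hb hab
  change combine W k y (a • z + b • z') ∈ S
  rw [combine_convexCombination hab]
  exact hS hz hz' ha hb hab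

lemma norm_combine_sub (hW : W ∈ Matrix.orthogonalGroup (Fin n) ℝ)
    (y : EuclideanSpace ℝ (ActiveIdx n k)) (z z' : EuclideanSpace ℝ (InactiveIdx n k)) :
    ‖combine W k y z' - combine W k y z‖ = ‖z' - z‖ := by
  have h : combine W k y z' - combine W k y z = combine W k 0 (z' - z) := by
    simp only [combine, map_sub, map_zero]
    abel
  rw [h, ← sq_eq_sq₀ (norm_nonneg _) (norm_nonneg _), norm_sq_combine hW]
  simp

/-- Exhibits the inner parallel set as the complement of an open set, which gives its measurability.
-/
lemma setOf_ball_subset_eq (t : ℝ) :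
    {x | Metric.ball x t ⊆ S} = (Metric.thickening t Sᶜ)ᶜ := by
  ext x
  simp only [Set.mem_ofPred_eq, Set.mem_compl_iff, Metric.mem_thickening_iff, not_exists, not_and,
    not_lt]
  constructor
  · intro h z hz
    by_contra! hlt
    exact hz (h (Metric.mem_ball'.2 hlt))
  · intro h z hz
    by_contra hzS
    exact absurd (Metric.mem_ball'.1 hz) (not_lt.2 (h z hzS))

/-- A point near `a x + b x'` is the same combination of `x` and `x'` shifted by one common
displacement. -/
lemma convex_setOf_ball_subset (hS : Convex ℝ S) (t : ℝ) :
    Convex ℝ {x | Metric.ball x t ⊆ S} := by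
  intro x hx x' hx' a b ha hb hab w hw
  have e : w = a • (x + (w - (a • x + b • x'))) + b • (x' + (w - (a • x + b • x'))) := by
    have : w - (a • x + b • x') = (a + b) • (w - (a • x + b • x')) := by rw [hab, one_smul]
    have h2 : a • (x + (w - (a • x + b • x'))) + b • (x' + (w - (a • x + b • x'))) =
      a • x + b • x' + (a + b) • (w - (a • x + b • x')) := by module
    rw [h2, ← this]
    abel
  rw [e]
  rw [Metric.mem_ball, dist_eq_norm] at hw
  exact hS (hx (by simpa using hw)) (hx' (by simpa using hw)) ha hb hab

lemma uniformDensity_nonneg (x : EuclideanSpace ℝ (Fin n)) : 0 ≤ uniformDensity S x :=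
  Set.indicator_nonneg (fun _ _ => by positivity) x

lemma measurable_uniformDensity (hS : MeasurableSet S) : Measurable (uniformDensity S) :=
  measurable_const.indicator hS

lemma volume_real_pos {ι : Type*} [Fintype ι] {S : Set (EuclideanSpace ℝ ι)} (hne : S.Nonempty) (ho : IsOpen S) (hb : Bornology.IsBounded S) :
    0 < volume.real S :=
  ENNReal.toReal_pos (ho.measure_pos volume hne).ne' hb.measure_lt_top.ne

lemma domain_uniformDensity (hne : S.Nonempty) (ho : IsOpen S) (hb : Bornology.IsBounded S) :
    domain (uniformDensity S) = S := by
  have h := volume_real_pos hne ho hb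
  ext x
  by_cases hx : x ∈ S
  · simp [domain, uniformDensity, hx, h]
  · simp [domain, uniformDensity, hx]

/-- The density is constant on `S`, so the only issue is room. Halving the radius makes closed balls
fit into the open ball contained in `S`. Segments stay in a convex set, so the same set serves on
both sides. -/
lemma isExhaustion_uniformDensity (hne : S.Nonempty) (ho : IsOpen S)
    (hb : Bornology.IsBounded S) :
    IsExhaustion (uniformDensity S) (fun m => {x | Metric.ball x (1 / ((m : ℝ) + 1)) ⊆ S})
      (fun m => {x | Metric.ball x (1 / ((m : ℝ) + 1)) ⊆ S}) (fun m => 1 / ((m : ℝ) + 1) / 2) := by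
  have hm : ∀ m : ℕ, MeasurableSet {x | Metric.ball x (1 / ((m : ℝ) + 1)) ⊆ S} := fun m => by
    rw [setOf_ball_subset_eq]
    exact Metric.isOpen_thickening.measurableSet.compl
  refine ⟨hm, hm, fun m => by positivity, fun m x hx u hu => ?_, fun x hx => ?_⟩
  · have hpos : (0 : ℝ) < 1 / ((m : ℝ) + 1) := by positivity
    have hxS : x ∈ S := hx (Metric.mem_ball_self hpos)
    have huS : u ∈ S := hx (Metric.mem_ball.2 (hu.trans_lt (half_lt_self hpos)))
    rw [domain_uniformDensity hne ho hb]
    refine ⟨huS, ?_⟩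
    simp only [uniformDensity, Set.indicator_of_mem hxS, Set.indicator_of_mem huS]
    exact le_mul_of_one_le_left' (by norm_num)
  · rw [domain_uniformDensity hne ho hb] at hx
    obtain ⟨ε, hε, hball⟩ := Metric.isOpen_iff.1 ho x hx
    filter_upwards [(tendsto_one_div_add_atTop_nhds_zero_nat (𝕜 := ℝ)).eventually_lt_const hε]
      with m hm
    exact (Metric.ball_subset_ball hm.le).trans hball

/-- The conditional law is uniform on the slice `S_y`, and on pairs in the slice the pair density is
the constant `1 / (|S| |S_y|)`. The factor `|A_y|` of the convex Poincaré inequality is absorbed by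
`1 / |S_y|`, so the constant is free of `y` and of the direction of slicing. -/
lemma sliceInequality_uniformDensity (hne : S.Nonempty) (ho : IsOpen S)
    (hb : Bornology.IsBounded S) (hW : W ∈ Matrix.orthogonalGroup (Fin n) ℝ)
    {A : Set (EuclideanSpace ℝ (Fin n))} (hA : Convex ℝ A) (hAm : MeasurableSet A) (hAS : A ⊆ S)
    {d : ℝ} (hd : ∀ x ∈ S, ∀ x' ∈ S, ‖x' - x‖ ≤ d) :
    SliceInequality (uniformDensity S) A A (ENNReal.ofReal d ^ 2 * 2 ^ n) W k := by
  rintro g hg y ⟨x, hx, rfl⟩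
  obtain ⟨z₀, hz₀⟩ := exists_combine (k := k) hW x
  rw [domain_uniformDensity hne ho hb] at hx
  set y := activeVar W k x
  have hcont : Continuous (combine W k y) := (contDiff_combine y).continuous
  have hv := volume_real_pos hne ho hb
  have hSo : IsOpen (slice W S y) := ho.preimage hcont
  have hSb : Bornology.IsBounded (slice W S y) := by
    rw [Metric.isBounded_iff]
    refine ⟨d, fun z hz z' hz' => ?_⟩
    rw [dist_eq_norm', ← norm_combine_sub hW y z z']
    exact hd _ hz _ hz'
  have hV := volume_real_pos ⟨z₀, show combine W k y z₀ ∈ S from hz₀ ▸ hx⟩ hSo hSb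
  have hdens : ∀ z, uniformDensity S (combine W k y z) =
      (slice W S y).indicator (fun _ => (volume.real S)⁻¹) z := fun z => rfl
  have hmarg : marginalDensity (uniformDensity S) W k y =
      volume.real (slice W S y) * (volume.real S)⁻¹ := by
    simp only [marginalDensity, hdens]
    rw [integral_indicator hSo.measurableSet, setIntegral_const, smul_eq_mul]
  have hpair : ∀ p ∈ slice W A y ×ˢ slice W A y, pairDensity (uniformDensity S) W k y p =
      ENNReal.ofReal (volume.real S)⁻¹ * ENNReal.ofReal (volume.real (slice W S y))⁻¹ := by
    intro p hp
    have h1 : p.1 ∈ slice W S y := hAS hp.1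
    have h2 : p.2 ∈ slice W S y := hAS hp.2
    simp only [pairDensity, condDensity, hmarg, hdens, Set.indicator_of_mem h1,
      Set.indicator_of_mem h2]
    rw [← ENNReal.ofReal_mul (by positivity), ← ENNReal.ofReal_mul (by positivity),
      ← ENNReal.ofReal_mul (by positivity)]
    congr 1
    field_simp
  have hAy := measurableSet_slice (W := W) hAm y
  have hrhs : ∫⁻ z in slice W A y, ‖fderiv ℝ (fun z => g (combine W k y z)) z‖ₑ ^ 2 *
      ENNReal.ofReal (uniformDensity S (combine W k y z)) =
      (∫⁻ z in slice W A y, ‖fderiv ℝ (fun z => g (combine W k y z)) z‖ₑ ^ 2) *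
        ENNReal.ofReal (volume.real S)⁻¹ := by
    rw [← lintegral_mul_const' _ _ ENNReal.ofReal_ne_top]
    refine setLIntegral_congr_fun hAy fun z hz => ?_
    simp only [hdens, Set.indicator_of_mem (show z ∈ slice W S y from hAS hz)]
  have hmass : ENNReal.ofReal (volume.real (slice W S y))⁻¹ * volume (slice W A y) ≤ 1 := by
    calc _ ≤ ENNReal.ofReal (volume.real (slice W S y))⁻¹ * volume (slice W S y) :=
          mul_le_mul' le_rfl (measure_mono fun z hz => hAS hz)
      _ = 1 := by
        rw [← ENNReal.ofReal_toReal hSb.measure_lt_top.ne, ← ENNReal.ofReal_mul (by positivity)]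
        change ENNReal.ofReal ((volume.real (slice W S y))⁻¹ * volume.real (slice W S y)) = 1
        rw [inv_mul_cancel₀ hV.ne', ENNReal.ofReal_one]
  have hcard : (2 : ℝ≥0∞) ^ Fintype.card (InactiveIdx n k) ≤ 2 ^ n :=
    pow_le_pow_right₀ (by norm_num) ((Fintype.card_subtype_le _).trans_eq (Fintype.card_fin n))
  calc _ = ∫⁻ p in slice W A y ×ˢ slice W A y,
        ‖g (combine W k y p.1) - g (combine W k y p.2)‖ₑ ^ 2 *
          (ENNReal.ofReal (volume.real S)⁻¹ * ENNReal.ofReal (volume.real (slice W S y))⁻¹) :=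
        setLIntegral_congr_fun (hAy.prod hAy) fun p hp => by rw [hpair p hp]
    _ = (∫⁻ p in slice W A y ×ˢ slice W A y,
        ‖g (combine W k y p.1) - g (combine W k y p.2)‖ₑ ^ 2) *
          (ENNReal.ofReal (volume.real S)⁻¹ * ENNReal.ofReal (volume.real (slice W S y))⁻¹) :=
        lintegral_mul_const' _ _ (by finiteness)
    _ ≤ (ENNReal.ofReal d ^ 2 * 2 ^ Fintype.card (InactiveIdx n k) * volume (slice W A y) *
          ∫⁻ z in slice W A y, ‖fderiv ℝ (fun z => g (combine W k y z)) z‖ₑ ^ 2) *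
          (ENNReal.ofReal (volume.real S)⁻¹ * ENNReal.ofReal (volume.real (slice W S y))⁻¹) := by
        refine mul_le_mul_left (lintegral_prod_pairs_le_of_convex (convex_slice hA y) hAy
          (fun z hz z' hz' => ?_) (hg.comp (contDiff_combine y))) _
        rw [← norm_combine_sub hW y z z']
        exact hd _ (hAS hz) _ (hAS hz')
    _ = (ENNReal.ofReal (volume.real (slice W S y))⁻¹ * volume (slice W A y)) *
        (ENNReal.ofReal d ^ 2 * 2 ^ Fintype.card (InactiveIdx n k) *
          ((∫⁻ z in slice W A y, ‖fderiv ℝ (fun z => g (combine W k y z)) z‖ₑ ^ 2) *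
          ENNReal.ofReal (volume.real S)⁻¹)) := by ring
    _ ≤ 1 * (ENNReal.ofReal d ^ 2 * 2 ^ n *
          ((∫⁻ z in slice W A y, ‖fderiv ℝ (fun z => g (combine W k y z)) z‖ₑ ^ 2) *
          ENNReal.ofReal (volume.real S)⁻¹)) := by
        gcongr
    _ = _ := by rw [one_mul, hrhs]

end Uniform

/-! ### The standard normal distribution -/

section Normal

variable {k : ℕ} {W : Matrix (Fin n) (Fin n) ℝ}

lemma stdNormalDensity_pos (x : EuclideanSpace ℝ (Fin n)) : 0 < stdNormalDensity x :=
  mul_pos (Real.rpow_pos_of_pos (by positivity) _) (Real.exp_pos _)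

lemma measurable_stdNormalDensity : Measurable (stdNormalDensity (n := n)) := by
  unfold stdNormalDensity
  fun_prop

lemma domain_stdNormalDensity : domain (stdNormalDensity (n := n)) = Set.univ :=
  Set.eq_univ_of_forall stdNormalDensity_pos

/-- With `δ = dist u x`, one has `‖u‖² ≤ ‖x‖² + 4mδ + δ² ≤ ‖x‖² + 1`, so the densities differ at
most by the factor `exp (1/2) ≤ 2`. -/
lemma stdNormalDensity_le_two_mul {m : ℕ} {x u : EuclideanSpace ℝ (Fin n)}
    (hx : ‖x‖ ≤ 2 * m) (hu : dist u x ≤ 1 / (4 * m + 1)) :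
    stdNormalDensity x ≤ 2 * stdNormalDensity u := by
  have hm : (0 : ℝ) ≤ m := Nat.cast_nonneg m
  have hpos : (0 : ℝ) < 4 * m + 1 := by positivity
  have hδ : (4 * m + 1) * dist u x ≤ 1 := by
    rw [le_div_iff₀ hpos] at hu
    linarith
  have hd0 : 0 ≤ dist u x := dist_nonneg
  have hd1 : dist u x ≤ 1 := by nlinarith
  have hn : ‖u‖ ≤ ‖x‖ + dist u x := by
    rw [dist_eq_norm]
    calc ‖u‖ = ‖x + (u - x)‖ := by congr 1; abel
      _ ≤ _ := norm_add_le _ _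
  have hsq : ‖u‖ ^ 2 ≤ ‖x‖ ^ 2 + 1 := by
    have h1 : ‖u‖ ^ 2 ≤ (‖x‖ + dist u x) ^ 2 := pow_le_pow_left₀ (norm_nonneg _) hn 2
    nlinarith [mul_le_mul_of_nonneg_right hx hd0, mul_le_mul_of_nonneg_right hd1 hd0]
  have hexp : Real.exp (1 / 2) ≤ 2 := by
    rw [← Real.le_log_iff_exp_le (by norm_num)]
    linarith [Real.log_two_gt_d9]
  have h : Real.exp (-‖x‖ ^ 2 / 2) ≤ 2 * Real.exp (-‖u‖ ^ 2 / 2) := by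
    calc Real.exp (-‖x‖ ^ 2 / 2) ≤ Real.exp (1 / 2 + -‖u‖ ^ 2 / 2) :=
          Real.exp_le_exp.2 (by linarith)
      _ = Real.exp (1 / 2) * Real.exp (-‖u‖ ^ 2 / 2) := Real.exp_add _ _
      _ ≤ _ := by gcongr
  unfold stdNormalDensity
  have hc : (0 : ℝ) ≤ (2 * Real.pi) ^ (-(n : ℝ) / 2) := by positivity
  nlinarith [mul_le_mul_of_nonneg_left h hc]

/-- The gradient balls have twice the radius because the arcs between two points of a slice of the
ball of radius `m` may leave that ball. -/
lemma isExhaustion_stdNormalDensity :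
    IsExhaustion (stdNormalDensity (n := n)) (fun m => Metric.closedBall 0 m)
      (fun m => Metric.closedBall 0 (2 * m)) (fun m => 1 / (4 * m + 1)) where
  measurable_left m := Metric.isClosed_closedBall.measurableSet
  measurable_right m := Metric.isClosed_closedBall.measurableSet
  pos m := by positivity
  near m x hx u hu := by
    refine ⟨stdNormalDensity_pos u, ?_⟩
    rw [show (2 : ℝ≥0∞) = ENNReal.ofReal 2 by simp, ← ENNReal.ofReal_mul (by norm_num)]
    exact ENNReal.ofReal_le_ofReal
      (stdNormalDensity_le_two_mul (mem_closedBall_zero_iff.1 hx) hu)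
  eventually_mem x _ := by
    filter_upwards [eventually_ge_atTop ⌈‖x‖⌉₊] with m hm
    exact mem_closedBall_zero_iff.2 ((Nat.le_ceil _).trans (by exact_mod_cast hm))

/-- The constant in the Poincaré inequality for the standard normal distribution on the slices. -/
def normalSliceConst (n k : ℕ) : ℝ≥0∞ :=
  ENNReal.ofReal (∫ z : EuclideanSpace ℝ (InactiveIdx n k), Real.exp (-‖z‖ ^ 2 / 2))⁻¹ *
    (ENNReal.ofReal (Real.pi / 2) ^ 2 *
      ∫⁻ z : EuclideanSpace ℝ (InactiveIdx n k), ‖z‖ₑ ^ 2 * gaussWeight z)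

lemma normalSliceConst_ne_top (n k : ℕ) : normalSliceConst n k ≠ ∞ := by
  have := lintegral_sq_mul_gaussWeight_ne_top (ι := InactiveIdx n k)
  unfold normalSliceConst
  finiteness

/-- By rotation invariance the squared norm of the arc point is at most `‖z‖² + ‖z'‖²`. Adding
`‖y‖²` gives at most `2R² ≤ (2R)²`. -/
lemma cos_smul_add_sin_smul_mem_slice (hW : W ∈ Matrix.orthogonalGroup (Fin n) ℝ) {R : ℝ}
    (hR : 0 ≤ R) {y : EuclideanSpace ℝ (ActiveIdx n k)} {z z' : EuclideanSpace ℝ (InactiveIdx n k)}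
    (hz : z ∈ slice W (Metric.closedBall 0 R) y) (hz' : z' ∈ slice W (Metric.closedBall 0 R) y)
    (θ : ℝ) :
    Real.cos θ • z + Real.sin θ • z' ∈ slice W (Metric.closedBall 0 (2 * R)) y := by
  have h1 : ‖combine W k y z‖ ^ 2 ≤ R ^ 2 :=
    pow_le_pow_left₀ (norm_nonneg _) (mem_closedBall_zero_iff.1 hz) 2
  have h2 : ‖combine W k y z'‖ ^ 2 ≤ R ^ 2 :=
    pow_le_pow_left₀ (norm_nonneg _) (mem_closedBall_zero_iff.1 hz') 2
  rw [norm_sq_combine hW] at h1 h2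
  have h3 := norm_sq_rotate θ (z, z')
  simp only [rotate] at h3
  refine mem_closedBall_zero_iff.2 ((sq_le_sq₀ (norm_nonneg _) (by positivity)).1 ?_)
  rw [norm_sq_combine hW]
  nlinarith [sq_nonneg ‖-Real.sin θ • z + Real.cos θ • z'‖, sq_nonneg ‖y‖]

/-- On a slice the density is `c exp (-‖z‖² / 2)` with `c` depending only on `y`. With `I` the mass
of the weight, the pair density is `c / I` times the product weight; `c` appears on both sides and
drops out. -/
lemma sliceInequality_stdNormalDensity (hW : W ∈ Matrix.orthogonalGroup (Fin n) ℝ)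
    {A B : Set (EuclideanSpace ℝ (Fin n))} (hA : MeasurableSet A) (hB : MeasurableSet B)
    (hAB : ∀ y : EuclideanSpace ℝ (ActiveIdx n k), ∀ z ∈ slice W A y, ∀ z' ∈ slice W A y,
      ∀ θ : ℝ, Real.cos θ • z + Real.sin θ • z' ∈ slice W B y) :
    SliceInequality (stdNormalDensity (n := n)) A B (normalSliceConst n k) W k := by
  rintro g hg y -
  have hAy := measurableSet_slice (W := W) hA y
  have hBy := measurableSet_slice (W := W) hB y
  have hgy : ContDiff ℝ 1 fun z => g (combine W k y z) := hg.comp (contDiff_combine y)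
  have key := lintegral_prod_pairs_le_gaussWeight hAy hBy (hAB y) hgy
  set I := ∫ z : EuclideanSpace ℝ (InactiveIdx n k), Real.exp (-‖z‖ ^ 2 / 2) with hI
  have hIpos : 0 < I := by
    refine integral_exp_pos ((integrable_exp_neg_mul_sq_norm (ι := InactiveIdx n k) (b := 1 / 2)
      (by norm_num)).congr (Eventually.of_forall fun z => ?_))
    simp only
    congr 1
    ring
  obtain ⟨c, hcpos, hdens⟩ : ∃ c : ℝ, 0 < c ∧
      ∀ z, stdNormalDensity (combine W k y z) = c * Real.exp (-‖z‖ ^ 2 / 2) := by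
    refine ⟨(2 * Real.pi) ^ (-(n : ℝ) / 2) * Real.exp (-‖y‖ ^ 2 / 2),
      mul_pos (Real.rpow_pos_of_pos (by positivity) _) (Real.exp_pos _), fun z => ?_⟩
    rw [stdNormalDensity, norm_sq_combine hW, mul_assoc, ← Real.exp_add]
    congr 2
    ring
  have hmarg : marginalDensity stdNormalDensity W k y = c * I := by
    simp only [marginalDensity, hdens]
    rw [integral_const_mul]
  have hpair : ∀ p, pairDensity stdNormalDensity W k y p =
      ENNReal.ofReal (c * I⁻¹) * (gaussWeight p.1 * gaussWeight p.2) := by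
    intro p
    simp only [pairDensity, condDensity, hmarg, hdens, gaussWeight]
    rw [← ENNReal.ofReal_mul (by positivity), ← ENNReal.ofReal_mul (by positivity),
      ← ENNReal.ofReal_mul (by positivity), ← ENNReal.ofReal_mul (by positivity)]
    congr 1
    field_simp
  have hlhs : ∫⁻ p in slice W A y ×ˢ slice W A y,
      ‖g (combine W k y p.1) - g (combine W k y p.2)‖ₑ ^ 2 *
        pairDensity stdNormalDensity W k y p =
      ENNReal.ofReal (c * I⁻¹) * ∫⁻ p in slice W A y ×ˢ slice W A y,
        ‖g (combine W k y p.1) - g (combine W k y p.2)‖ₑ ^ 2 *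
          (gaussWeight p.1 * gaussWeight p.2) := by
    rw [← lintegral_const_mul' _ _ ENNReal.ofReal_ne_top]
    refine lintegral_congr fun p => ?_
    rw [hpair]
    ring
  have hrhs : ∫⁻ z in slice W B y, ‖fderiv ℝ (fun z => g (combine W k y z)) z‖ₑ ^ 2 *
        ENNReal.ofReal (stdNormalDensity (combine W k y z)) =
      ENNReal.ofReal c * ∫⁻ z in slice W B y,
        ‖fderiv ℝ (fun z => g (combine W k y z)) z‖ₑ ^ 2 * gaussWeight z := by
    rw [← lintegral_const_mul' _ _ ENNReal.ofReal_ne_top]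
    refine lintegral_congr fun z => ?_
    rw [hdens, ENNReal.ofReal_mul hcpos.le, gaussWeight]
    ring
  rw [hlhs, hrhs]
  refine (mul_le_mul' le_rfl key).trans (le_of_eq ?_)
  rw [normalSliceConst, ENNReal.ofReal_mul hcpos.le]
  ring

end Normal

/-- For the densities considered, the conditional Poincaré inequality holds along an exhaustion. -/
theorem IsUniformOrNormal.exists_isExhaustion {ρ : EuclideanSpace ℝ (Fin n) → ℝ}
    (hρ : IsUniformOrNormal ρ) :
    Measurable ρ ∧ (∀ x, 0 ≤ ρ x) ∧ IsOpen (domain ρ) ∧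
      ∃ A B δ, IsExhaustion ρ A B δ ∧ ∃ K : ℕ → ℝ≥0∞, (∀ k, K k ≠ ∞) ∧
        ∀ W ∈ Matrix.orthogonalGroup (Fin n) ℝ, ∀ k m, SliceInequality ρ (A m) (B m) (K k) W k := by
  rcases hρ with ⟨S, hne, ho, hb, hS, rfl⟩ | rfl
  · refine ⟨measurable_uniformDensity ho.measurableSet, uniformDensity_nonneg, ?_, _, _, _,
      isExhaustion_uniformDensity hne ho hb, fun _ => ENNReal.ofReal (Metric.diam S) ^ 2 * 2 ^ n,
      fun k => by finiteness, fun W hW k m => ?_⟩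
    · rwa [domain_uniformDensity hne ho hb]
    · have hpos : (0 : ℝ) < 1 / ((m : ℝ) + 1) := by positivity
      exact sliceInequality_uniformDensity hne ho hb hW (convex_setOf_ball_subset hS _)
        ((isExhaustion_uniformDensity hne ho hb).measurable_left m)
        (fun x hx => hx (Metric.mem_ball_self hpos)) fun x hx x' hx' => by
          rw [← dist_eq_norm]
          exact Metric.dist_le_diam_of_mem hb hx' hx
  · refine ⟨measurable_stdNormalDensity, fun x => (stdNormalDensity_pos x).le, ?_, _, _, _,
      isExhaustion_stdNormalDensity, normalSliceConst n, normalSliceConst_ne_top n,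
      fun W hW k m => sliceInequality_stdNormalDensity hW
        (isExhaustion_stdNormalDensity.measurable_left m)
        (isExhaustion_stdNormalDensity.measurable_right m) fun y z hz z' hz' θ =>
          cos_smul_add_sin_smul_mem_slice hW (Nat.cast_nonneg m) hz hz' θ⟩
    rw [domain_stdNormalDensity]
    exact isOpen_univ

/-! ### The inactive energy in terms of the eigenvalues -/

section Energy

variable {k : ℕ} {ρ f : EuclideanSpace ℝ (Fin n) → ℝ}

lemma gradientMatrix_eq_integral_law (hρ : Measurable ρ) (hρ0 : ∀ x, 0 ≤ ρ x) (i j : Fin n) :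
    gradientMatrix ρ f i j = ∫ x, partialDeriv f i x * partialDeriv f j x ∂(law ρ) := by
  rw [law, integral_withDensity_eq_integral_toReal_smul hρ.ennreal_ofReal
    (Eventually.of_forall fun x => ENNReal.ofReal_lt_top)]
  simp only [gradientMatrix, Matrix.of_apply]
  rw [setIntegral_eq_integral_of_forall_compl_eq_zero]
  · refine integral_congr_ae (Eventually.of_forall fun x => ?_)
    simp only [ENNReal.toReal_ofReal (hρ0 x), smul_eq_mul]
    ring
  · intro x hx
    rw [le_antisymm (not_lt.1 hx) (hρ0 x), mul_zero]

/-- The quadratic form of the gradient matrix at `v` is the second moment of `v · ∇f`. Nonnegativity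
is kept as a separate conclusion because `ENNReal.ofReal` would conceal a negative value. -/
lemma lintegral_directional_sq (hρ : Measurable ρ) (hρ0 : ∀ x, 0 ≤ ρ x)
    (hf : HasSquareIntegrablePartials ρ f) (v : Fin n → ℝ) :
    ∫⁻ x, ‖∑ i, v i * (domain ρ).indicator (partialDeriv f i) x‖ₑ ^ 2 * ENNReal.ofReal (ρ x) =
        ENNReal.ofReal (∑ i, ∑ j, v i * v j * gradientMatrix ρ f i j) ∧
      0 ≤ ∑ i, ∑ j, v i * v j * gradientMatrix ρ f i j := by
  have hint : ∀ i j, Integrable (fun x => partialDeriv f i x * partialDeriv f j x) (law ρ) :=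
    fun i j => (hf.memLp i).integrable_mul (hf.memLp j)
  have hexp : ∀ x, (∑ i, v i * partialDeriv f i x) ^ 2 =
      ∑ i, ∑ j, v i * v j * (partialDeriv f i x * partialDeriv f j x) := fun x => by
    rw [sq, Finset.sum_mul_sum]
    exact Finset.sum_congr rfl fun i _ => Finset.sum_congr rfl fun j _ => by ring
  have hi2 : ∀ i, Integrable (fun x => ∑ j, v i * v j * (partialDeriv f i x * partialDeriv f j x))
      (law ρ) := fun i => integrable_finsetSum _ fun j _ => (hint i j).const_mul _
  have hquad : ∑ i, ∑ j, v i * v j * gradientMatrix ρ f i j =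
      ∫ x, (∑ i, v i * partialDeriv f i x) ^ 2 ∂(law ρ) := by
    simp only [hexp]
    rw [integral_finsetSum _ fun i _ => hi2 i]
    refine Finset.sum_congr rfl fun i _ => ?_
    rw [integral_finsetSum _ fun j _ => (hint i j).const_mul _]
    refine Finset.sum_congr rfl fun j _ => ?_
    rw [integral_const_mul, gradientMatrix_eq_integral_law hρ hρ0]
  have hisq : Integrable (fun x => (∑ i, v i * partialDeriv f i x) ^ 2) (law ρ) := by
    simp only [hexp]
    exact integrable_finsetSum _ fun i _ => hi2 i
  rw [hquad]
  refine ⟨?_, integral_nonneg fun x => sq_nonneg _⟩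
  rw [ofReal_integral_eq_lintegral_ofReal hisq (Eventually.of_forall fun x => sq_nonneg _), law,
    lintegral_withDensity_eq_lintegral_mul_non_measurable _ hρ.ennreal_ofReal
      (Eventually.of_forall fun x => ENNReal.ofReal_lt_top)]
  refine lintegral_congr fun x => ?_
  by_cases hx : x ∈ domain ρ
  · simp only [Set.indicator_of_mem hx, Pi.mul_apply]
    rw [Real.enorm_eq_ofReal_abs, ← ENNReal.ofReal_pow (abs_nonneg _), sq_abs, mul_comm]
  · have h0 : ρ x = 0 := le_antisymm (not_lt.1 hx) (hρ0 x)
    simp [h0]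

variable {W What : Matrix (Fin n) (Fin n) ℝ} {lam : Fin n → ℝ}

lemma quadraticForm_eq {C : Matrix (Fin n) (Fin n) ℝ} (hC : IsEigendecomposition C W lam)
    (v : Fin n → ℝ) :
    ∑ i, ∑ j, v i * v j * C i j = ∑ l, lam l * (∑ i, W i l * v i) ^ 2 := by
  have hCij : ∀ i j, C i j = ∑ l, lam l * (W i l * W j l) := fun i j => by
    rw [hC.eq, Matrix.mul_apply]
    exact Finset.sum_congr rfl fun l _ => by
      rw [Matrix.mul_diagonal, Matrix.transpose_apply]; ring
  simp only [hCij, Finset.mul_sum, sq, Finset.sum_mul]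
  rw [Finset.sum_congr rfl fun i _ => Finset.sum_comm, Finset.sum_comm]
  refine Finset.sum_congr rfl fun l _ => ?_
  rw [Finset.sum_comm]
  exact Finset.sum_congr rfl fun i _ => Finset.sum_congr rfl fun j _ => by ring

lemma sum_mul_self_column (hW : W ∈ Matrix.orthogonalGroup (Fin n) ℝ) (l j : Fin n) :
    ∑ i, W i l * W i j = if l = j then 1 else 0 := by
  have h : W.transpose * W = 1 := by
    simpa [Matrix.star_eq_conjTranspose] using (Matrix.mem_unitaryGroup_iff'.1 hW)
  have := congrFun (congrFun h l) j
  simpa [Matrix.mul_apply, Matrix.one_apply] using this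

lemma sum_sq_inner_column (hW : What ∈ Matrix.orthogonalGroup (Fin n) ℝ)
    (u : EuclideanSpace ℝ (Fin n)) : ∑ j, (∑ i, u i * What i j) ^ 2 = ‖u‖ ^ 2 := by
  rw [← norm_toEuclideanLin (transpose_mem_orthogonalGroup hW) u, EuclideanSpace.norm_sq_eq]
  refine Finset.sum_congr rfl fun j _ => ?_
  rw [Real.norm_eq_abs, sq_abs]
  simp [Matrix.toLpLin_apply, Matrix.mulVec, dotProduct, mul_comm]

lemma sum_subtype_le {p : Fin n → Prop} [DecidablePred p] {F : Fin n → ℝ} (hF : ∀ i, 0 ≤ F i) :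
    ∑ i : {i // p i}, F i ≤ ∑ i, F i := by
  rw [← Fintype.sum_subtype_add_sum_subtype p F]
  exact le_add_of_nonneg_right (Finset.sum_nonneg fun i _ => hF i)

lemma sum_inactive_le_one (hW : W ∈ Matrix.orthogonalGroup (Fin n) ℝ)
    (hWhat : What ∈ Matrix.orthogonalGroup (Fin n) ℝ) (l : Fin n) :
    ∑ j : InactiveIdx n k, (∑ i, W i l * What i j) ^ 2 ≤ 1 := by
  refine (sum_subtype_le fun j => sq_nonneg (∑ i, W i l * What i j)).trans (le_of_eq ?_)
  have h := sum_sq_inner_column hWhat (column W l)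
  rw [EuclideanSpace.norm_sq_eq] at h
  simp only [column, Real.norm_eq_abs, sq_abs] at h
  rw [h]
  simpa [sq] using sum_mul_self_column hW l l

/-- For an active `l` and an inactive `j`, `ŵ_l` is orthogonal to `ŵ_j`, so `w_l` may be replaced by
`w_l - ŵ_l`. This is the image of a unit vector under `W - What`, hence of norm at most `ε`;
Parseval in the basis `ŵ_j` concludes. -/
lemma sum_inactive_le_sq (hWhat : What ∈ Matrix.orthogonalGroup (Fin n) ℝ) {ε : ℝ}
    (hε : ‖Matrix.toEuclideanCLM (n := Fin n) (𝕜 := ℝ) (W - What)‖ ≤ ε) {l : Fin n}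
    (hl : (l : ℕ) < k) :
    ∑ j : InactiveIdx n k, (∑ i, W i l * What i j) ^ 2 ≤ ε ^ 2 := by
  set u : EuclideanSpace ℝ (Fin n) := WithLp.toLp 2 fun i => W i l - What i l with hu
  have h1 : ∀ j : InactiveIdx n k, ∑ i, W i l * What i j = ∑ i, u i * What i j := fun j => by
    have hne : l ≠ j := fun h => j.2 (h ▸ hl)
    have h0 := sum_mul_self_column hWhat l j
    rw [if_neg hne] at h0
    simp only [hu, sub_mul, Finset.sum_sub_distrib, h0, sub_zero]
  have h2 : u = Matrix.toEuclideanCLM (n := Fin n) (𝕜 := ℝ) (W - What)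
      (EuclideanSpace.single l (1 : ℝ)) := by
    ext i
    simp [hu, Matrix.ofLp_toEuclideanCLM]
  have h3 : ‖u‖ ≤ ε := by
    rw [h2]
    refine (ContinuousLinearMap.le_opNorm _ _).trans ?_
    simpa using hε
  calc _ = ∑ j : InactiveIdx n k, (∑ i, u i * What i j) ^ 2 :=
        Finset.sum_congr rfl fun j _ => by rw [h1]
    _ ≤ ∑ j, (∑ i, u i * What i j) ^ 2 :=
        sum_subtype_le fun j => sq_nonneg (∑ i, u i * What i j)
    _ = ‖u‖ ^ 2 := sum_sq_inner_column hWhat u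
    _ ≤ ε ^ 2 := pow_le_pow_left₀ (norm_nonneg _) h3 2

/-- Each eigenvalue is the second moment of the derivative of `f` along its eigenvector. -/
lemma eigenvalue_nonneg (hρ : Measurable ρ) (hρ0 : ∀ x, 0 ≤ ρ x)
    (hf : HasSquareIntegrablePartials ρ f)
    (hC : IsEigendecomposition (gradientMatrix ρ f) W lam) (l : Fin n) : 0 ≤ lam l := by
  have h := (lintegral_directional_sq hρ hρ0 hf fun i => W i l).2
  rw [quadraticForm_eq hC] at h
  simpa [sum_mul_self_column hC.orthogonal] using h

/-- Diagonalise the form and exchange the sums over `j` and `l`: each `λ_l ≥ 0` is weighted by the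
squared length of the projection of `w_l` onto the inactive space of `What`, bounded by `ε²` for
active `l` and by `1` otherwise. -/
theorem inactiveEnergy_le (hρ : Measurable ρ) (hρ0 : ∀ x, 0 ≤ ρ x)
    (hf : HasSquareIntegrablePartials ρ f)
    (hC : IsEigendecomposition (gradientMatrix ρ f) W lam)
    (hWhat : What ∈ Matrix.orthogonalGroup (Fin n) ℝ) {ε : ℝ}
    (hε : ‖Matrix.toEuclideanCLM (n := Fin n) (𝕜 := ℝ) (W - What)‖ ≤ ε) :
    inactiveEnergy ρ What k f ≤ ENNReal.ofReal
      (ε ^ 2 * ∑ i : ActiveIdx n k, lam i + ∑ i : InactiveIdx n k, lam i) := by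
  have hlam := eigenvalue_nonneg hρ hρ0 hf hC
  have hD := fun j : InactiveIdx n k => lintegral_directional_sq hρ hρ0 hf fun i => What i j
  unfold inactiveEnergy
  rw [Finset.sum_congr rfl fun j _ => (hD j).1,
    ← ENNReal.ofReal_sum_of_nonneg fun j _ => (hD j).2]
  refine ENNReal.ofReal_le_ofReal ?_
  simp only [quadraticForm_eq hC]
  rw [Finset.sum_comm]
  simp only [← Finset.mul_sum]
  rw [sum_split (k := k), Finset.mul_sum]
  refine add_le_add (Finset.sum_le_sum fun l _ => ?_) (Finset.sum_le_sum fun l _ => ?_)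
  · rw [mul_comm]
    exact mul_le_mul_of_nonneg_right (sum_inactive_le_sq hWhat hε l.2) (hlam l)
  · exact mul_le_of_le_one_right (hlam l) (sum_inactive_le_one hC.orthogonal hWhat l)

end Energy

/-! ### The Monte Carlo error -/

section MonteCarlo

variable {k N : ℕ} {ρ : EuclideanSpace ℝ (Fin n) → ℝ} {W : Matrix (Fin n) (Fin n) ℝ}
  {Ω : Type*} [MeasurableSpace Ω] {P : Measure Ω}
  {Z : Fin N → EuclideanSpace ℝ (ActiveIdx n k) → Ω → EuclideanSpace ℝ (InactiveIdx n k)}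

/-- Convexity of the square: the error of a mean is the mean of the errors. -/
lemma ofReal_sq_sub_mean_le (hN : 0 < N) (t : ℝ) (s : Fin N → ℝ) :
    ENNReal.ofReal ((t - 1 / (N : ℝ) * ∑ j, s j) ^ 2) ≤
      ENNReal.ofReal (1 / (N : ℝ)) * ∑ j, ‖t - s j‖ₑ ^ 2 := by
  have hN' : (0 : ℝ) < N := by exact_mod_cast hN
  have h1 : t - 1 / (N : ℝ) * ∑ j, s j = 1 / (N : ℝ) * ∑ j, (t - s j) := by
    rw [Finset.sum_sub_distrib, Finset.sum_const, Finset.card_univ, Fintype.card_fin,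
      nsmul_eq_mul]
    field_simp
  have h2 : (∑ j, (t - s j)) ^ 2 ≤ N * ∑ j, (t - s j) ^ 2 := by
    simpa using sq_sum_le_card_mul_sum_sq (s := Finset.univ) (f := fun j => t - s j)
  have h3 : ∀ j, ‖t - s j‖ₑ ^ 2 = ENNReal.ofReal ((t - s j) ^ 2) := fun j => by
    rw [Real.enorm_eq_ofReal_abs, ← ENNReal.ofReal_pow (abs_nonneg _), sq_abs]
  simp only [h3]
  rw [← ENNReal.ofReal_sum_of_nonneg fun j _ => sq_nonneg _, ← ENNReal.ofReal_mul (by positivity),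
    h1]
  refine ENNReal.ofReal_le_ofReal ?_
  calc (1 / (N : ℝ) * ∑ j, (t - s j)) ^ 2 = (1 / (N : ℝ)) ^ 2 * (∑ j, (t - s j)) ^ 2 := by ring
    _ ≤ (1 / (N : ℝ)) ^ 2 * (N * ∑ j, (t - s j) ^ 2) := by gcongr
    _ = _ := by field_simp

lemma IsMonteCarloSample.measurable_apply (hZ : IsMonteCarloSample P ρ W k N Z)
    {y : EuclideanSpace ℝ (ActiveIdx n k)} (hy : y ∈ activeDomain ρ W k) (j : Fin N) :
    Measurable (Z j y) := by
  have h : Measurable fun ω : Ω => ((⟨y, hy⟩ : activeDomain ρ W k), ω) :=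
    measurable_const.prodMk measurable_id
  exact (hZ.measurable j).comp h

lemma IsMonteCarloSample.lintegral_sq_sub_le (hN : 0 < N) (hZ : IsMonteCarloSample P ρ W k N Z)
    {y : EuclideanSpace ℝ (ActiveIdx n k)} (hy : y ∈ activeDomain ρ W k) (hρ : Measurable ρ)
    {f : EuclideanSpace ℝ (Fin n) → ℝ} (hf : Measurable f) (t : ℝ) :
    ∫⁻ ω, ENNReal.ofReal ((t - monteCarlo f W k N Z y ω) ^ 2) ∂P ≤
      ∫⁻ z, ‖t - f (combine W k y z)‖ₑ ^ 2 * ENNReal.ofReal (condDensity ρ W k y z) := by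
  have hG : Measurable fun z => ‖t - f (combine W k y z)‖ₑ ^ 2 :=
    ((measurable_const.sub (hf.comp (measurable_combine_right y))).enorm).pow_const 2
  have hcond : Measurable fun z => ENNReal.ofReal (condDensity ρ W k y z) :=
    ((hρ.comp (measurable_combine_right y)).div_const _).ennreal_ofReal
  have hj : ∀ j, ∫⁻ ω, ‖t - f (combine W k y (Z j y ω))‖ₑ ^ 2 ∂P =
      ∫⁻ z, ‖t - f (combine W k y z)‖ₑ ^ 2 * ENNReal.ofReal (condDensity ρ W k y z) := by
    intro j
    rw [← lintegral_map hG (hZ.measurable_apply hy j), hZ.map_eq y hy j, condLaw,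
      lintegral_withDensity_eq_lintegral_mul _ hcond hG]
    exact lintegral_congr fun z => by rw [Pi.mul_apply, mul_comm]
  have hN' : (0 : ℝ) < N := by exact_mod_cast hN
  calc _ ≤ ∫⁻ ω, ENNReal.ofReal (1 / (N : ℝ)) *
        ∑ j, ‖t - f (combine W k y (Z j y ω))‖ₑ ^ 2 ∂P :=
        lintegral_mono fun ω => ofReal_sq_sub_mean_le hN t _
    _ = ENNReal.ofReal (1 / (N : ℝ)) * ∑ _j : Fin N,
        ∫⁻ z, ‖t - f (combine W k y z)‖ₑ ^ 2 * ENNReal.ofReal (condDensity ρ W k y z) := by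
        have hm : ∀ j, Measurable fun ω => ‖t - f (combine W k y (Z j y ω))‖ₑ ^ 2 := fun j =>
          hG.comp (hZ.measurable_apply hy j)
        rw [lintegral_const_mul' _ _ ENNReal.ofReal_ne_top, lintegral_finsetSum _ fun j _ => hm j]
        exact congrArg _ (Finset.sum_congr rfl fun j _ => hj j)
    _ = _ := by
        rw [Finset.sum_const, Finset.card_univ, Fintype.card_fin, nsmul_eq_mul, ← mul_assoc,
          ← ENNReal.ofReal_natCast N, ← ENNReal.ofReal_mul (by positivity),
          one_div_mul_cancel hN'.ne', ENNReal.ofReal_one, one_mul]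

/-- Were the marginal zero, division by zero would make the conditional density, hence the law of a
sample, vanish, contradicting total mass `1`. The existence of a sample thus replaces a direct
argument about the density. -/
lemma IsMonteCarloSample.marginalDensity_pos [IsProbabilityMeasure P] (hN : 0 < N)
    (hZ : IsMonteCarloSample P ρ W k N Z) (hρ0 : ∀ x, 0 ≤ ρ x)
    {y : EuclideanSpace ℝ (ActiveIdx n k)} (hy : y ∈ activeDomain ρ W k) :
    0 < marginalDensity ρ W k y := by
  refine lt_of_le_of_ne (integral_nonneg fun z => hρ0 _) fun h0 => ?_
  have h1 := hZ.map_eq y hy ⟨0, hN⟩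
  have h2 : condLaw ρ W k y = 0 := by
    simp [condLaw, condDensity, ← h0]
  have h3 : IsProbabilityMeasure (P.map (Z ⟨0, hN⟩ y)) :=
    Measure.isProbabilityMeasure_map (hZ.measurable_apply hy _).aemeasurable
  rw [h1, h2] at h3
  exact zero_ne_one h3.measure_univ

lemma IsMonteCarloSample.ae_mem_domain (hZ : IsMonteCarloSample P ρ W k N Z) (hρ : Measurable ρ)
    (hρ0 : ∀ x, 0 ≤ ρ x) {y : EuclideanSpace ℝ (ActiveIdx n k)} (hy : y ∈ activeDomain ρ W k)
    (j : Fin N) : ∀ᵐ ω ∂P, combine W k y (Z j y ω) ∈ domain ρ := by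
  have hρ0' : MeasurableSet {z | combine W k y z ∈ domain ρ} :=
    measurable_combine_right y (measurableSet_lt measurable_const hρ)
  have hcond : Measurable fun z => ENNReal.ofReal (condDensity ρ W k y z) :=
    ((hρ.comp (measurable_combine_right y)).div_const _).ennreal_ofReal
  have h : ∀ᵐ z ∂(condLaw ρ W k y), combine W k y z ∈ domain ρ := by
    rw [condLaw, ae_withDensity_iff hcond]
    refine Eventually.of_forall fun z hz => ?_
    by_contra hneg
    have h0 : ρ (combine W k y z) = 0 := le_antisymm (not_lt.1 hneg) (hρ0 _)
    exact hz (by simp [condDensity, h0])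
  rw [← hZ.map_eq y hy j] at h
  exact ae_of_ae_map (hZ.measurable_apply hy j).aemeasurable h

open Classical in
/-- The sample, extended by zero outside the active domain. -/
def extendSample (ρ : EuclideanSpace ℝ (Fin n) → ℝ) (W : Matrix (Fin n) (Fin n) ℝ)
    (Z : Fin N → EuclideanSpace ℝ (ActiveIdx n k) → Ω → EuclideanSpace ℝ (InactiveIdx n k))
    (j : Fin N) (y : EuclideanSpace ℝ (ActiveIdx n k)) (ω : Ω) :
    EuclideanSpace ℝ (InactiveIdx n k) :=
  if y ∈ activeDomain ρ W k then Z j y ω else 0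

lemma extendSample_of_mem {Ω : Type*}
    {Z : Fin N → EuclideanSpace ℝ (ActiveIdx n k) → Ω → EuclideanSpace ℝ (InactiveIdx n k)}
    {y : EuclideanSpace ℝ (ActiveIdx n k)} (hy : y ∈ activeDomain ρ W k) (j : Fin N) :
    extendSample ρ W Z j y = Z j y := by
  ext1 ω
  simp [extendSample, hy]

/-- Joint measurability is given only over the active domain as a subtype; the extension by zero
carries it to the whole space, as needed for exchanging the integrals over `x` and `ω`. -/
lemma IsMonteCarloSample.measurable_extendSample (hZ : IsMonteCarloSample P ρ W k N Z)
    (hY : MeasurableSet (activeDomain ρ W k)) (j : Fin N) :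
    Measurable fun p : EuclideanSpace ℝ (ActiveIdx n k) × Ω =>
      extendSample ρ W Z j p.1 p.2 := by
  classical
  have hs : MeasurableSet {p : EuclideanSpace ℝ (ActiveIdx n k) × Ω |
      p.1 ∈ activeDomain ρ W k} := measurable_fst hY
  have hsub : Measurable fun p : {p : EuclideanSpace ℝ (ActiveIdx n k) × Ω |
      p.1 ∈ activeDomain ρ W k} => ((⟨p.1.1, p.2⟩ : activeDomain ρ W k), p.1.2) :=
    (measurable_fst.comp measurable_subtype_coe).subtype_mk.prodMk
      (measurable_snd.comp measurable_subtype_coe)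
  have h := Measurable.dite ((hZ.measurable j).comp hsub)
    (measurable_const (a := (0 : EuclideanSpace ℝ (InactiveIdx n k)))) hs
  exact h

lemma IsMonteCarloSample.measurable_combine_extendSample (hZ : IsMonteCarloSample P ρ W k N Z)
    (hY : MeasurableSet (activeDomain ρ W k)) (j : Fin N) :
    Measurable fun p : Ω × EuclideanSpace ℝ (Fin n) =>
      combine W k (activeVar W k p.2) (extendSample ρ W Z j (activeVar W k p.2) p.1) := by
  have h0 : Measurable fun p : Ω × EuclideanSpace ℝ (Fin n) => activeVar W k p.2 :=
    continuous_activeVar.measurable.comp measurable_snd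
  have h1 : Measurable fun p : Ω × EuclideanSpace ℝ (Fin n) =>
      extendSample ρ W Z j (activeVar W k p.2) p.1 :=
    (hZ.measurable_extendSample hY j).comp (h0.prodMk measurable_fst)
  exact (measurable_combine (W := W) (k := k)).comp
    (g := fun p : EuclideanSpace ℝ (ActiveIdx n k) × EuclideanSpace ℝ (InactiveIdx n k) =>
      combine W k p.1 p.2)
    (f := fun p : Ω × EuclideanSpace ℝ (Fin n) =>
      (activeVar W k p.2, extendSample ρ W Z j (activeVar W k p.2) p.1)) (h0.prodMk h1)

lemma isOpen_activeDomain (hW : W ∈ Matrix.orthogonalGroup (Fin n) ℝ) (ho : IsOpen (domain ρ)) :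
    IsOpen (activeDomain ρ W k) := by
  rw [isOpen_iff_mem_nhds]
  rintro _ ⟨x, hx, rfl⟩
  obtain ⟨z, hz⟩ := exists_combine (k := k) hW x
  have hc : Continuous fun y => combine W k y z :=
    continuous_combine.comp (continuous_id.prodMk continuous_const)
  refine mem_of_superset (hc.continuousAt.preimage_mem_nhds (ho.mem_nhds (hz.symm ▸ hx)))
    fun y hy => ⟨combine W k y z, hy, activeVar_combine hW y z⟩

lemma ae_law_mem_domain (hρ : Measurable ρ) : ∀ᵐ x ∂(law ρ), x ∈ domain ρ := by
  rw [law, ae_withDensity_iff hρ.ennreal_ofReal]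
  exact Eventually.of_forall fun x hx => ENNReal.ofReal_pos.1 (pos_iff_ne_zero.2 hx)

/-- After exchanging the integrals and passing to coordinates `(y, z)`, the density factors as
marginal times conditional, and the bound for one fixed value supplies the second conditional copy.
The function `f'` is a measurable substitute for `f`, which is controlled only on the domain. -/
theorem IsMonteCarloSample.lintegral_error_le [IsProbabilityMeasure P] (hN : 0 < N)
    (hZ : IsMonteCarloSample P ρ W k N Z) (hW : W ∈ Matrix.orthogonalGroup (Fin n) ℝ)
    (hρ : Measurable ρ) (hρ0 : ∀ x, 0 ≤ ρ x) (ho : IsOpen (domain ρ))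
    {f f' : EuclideanSpace ℝ (Fin n) → ℝ} (hf' : Measurable f')
    (hff' : ∀ x ∈ domain ρ, f x = f' x) :
    ∫⁻ ω, ∫⁻ x, ENNReal.ofReal ((f x - ridgeMonteCarlo f W k N Z x ω) ^ 2) ∂(law ρ) ∂P ≤
      ∫⁻ q, pairDiff ρ W k f' q := by
  have hY := (isOpen_activeDomain (k := k) hW ho).measurableSet
  have hU := ho.measurableSet
  have hpt := fun j => hZ.measurable_combine_extendSample hY j
  set H : Ω × EuclideanSpace ℝ (Fin n) → ℝ≥0∞ := fun p => ENNReal.ofReal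
    ((f' p.2 - ridgeMonteCarlo f' W k N (extendSample ρ W Z) p.2 p.1) ^ 2) with hH
  have hHm : Measurable H := by
    have hsum : Measurable fun p : Ω × EuclideanSpace ℝ (Fin n) => ∑ j, f'
        (combine W k (activeVar W k p.2) (extendSample ρ W Z j (activeVar W k p.2) p.1)) :=
      Finset.measurable_sum _ fun j _ => hf'.comp (hpt j)
    exact (((hf'.comp measurable_snd).sub (hsum.const_mul _)).pow_const 2).ennreal_ofReal
  have hgood : MeasurableSet {p : EuclideanSpace ℝ (Fin n) × Ω | p.1 ∈ domain ρ ∧ ∀ j,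
      combine W k (activeVar W k p.1) (extendSample ρ W Z j (activeVar W k p.1) p.2) ∈
        domain ρ} := by
    have h := MeasurableSet.iInter fun j => ((hpt j).comp measurable_swap) hU
    convert (measurable_fst hU).inter h using 1
    ext p
    simp
  have hgood1 : ∀ᵐ x ∂(law ρ), ∀ᵐ ω ∂P, x ∈ domain ρ ∧ ∀ j,
      combine W k (activeVar W k x) (extendSample ρ W Z j (activeVar W k x) ω) ∈ domain ρ := by
    filter_upwards [ae_law_mem_domain hρ] with x hx
    have hy : activeVar W k x ∈ activeDomain ρ W k := ⟨x, hx, rfl⟩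
    filter_upwards [ae_all_iff.2 fun j => hZ.ae_mem_domain hρ hρ0 hy j] with ω hω
    refine ⟨hx, fun j => ?_⟩
    rw [extendSample_of_mem hy]
    exact hω j
  have : SFinite (law ρ) := by unfold law; infer_instance
  -- For almost every `x` all samples lie in the domain almost surely. The outer integral is over
  -- `ω`, so the order of the two quantifiers has to be exchanged, which uses measurability of the
  -- good set.
  have hgood2 := (Measure.ae_ae_comm hgood).1 hgood1
  have hΦm : Measurable fun x => ∫⁻ ω, H (ω, x) ∂P := hHm.lintegral_prod_left'
  calc ∫⁻ ω, ∫⁻ x, ENNReal.ofReal ((f x - ridgeMonteCarlo f W k N Z x ω) ^ 2) ∂(law ρ) ∂P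
      = ∫⁻ ω, ∫⁻ x, H (ω, x) ∂(law ρ) ∂P := by
        refine lintegral_congr_ae ?_
        filter_upwards [hgood2] with ω hω
        refine lintegral_congr_ae ?_
        filter_upwards [hω] with x hx
        have hy : activeVar W k x ∈ activeDomain ρ W k := ⟨x, hx.1, rfl⟩
        simp only [hH, ridgeMonteCarlo, monteCarlo, ← hff' x hx.1]
        congr 5
        ext1 j
        rw [← hff' _ (hx.2 j), extendSample_of_mem hy]
    _ = ∫⁻ x, ∫⁻ ω, H (ω, x) ∂P ∂(law ρ) := lintegral_lintegral_swap hHm.aemeasurable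
    _ = ∫⁻ x, ENNReal.ofReal (ρ x) * ∫⁻ ω, H (ω, x) ∂P :=
        lintegral_withDensity_eq_lintegral_mul _ hρ.ennreal_ofReal hΦm
    _ = ∫⁻ (y : EuclideanSpace ℝ (ActiveIdx n k)), ∫⁻ (z : EuclideanSpace ℝ (InactiveIdx n k)),
          ENNReal.ofReal (ρ (combine W k y z)) * ∫⁻ ω, H (ω, combine W k y z) ∂P :=
        lintegral_eq_lintegral_combine hW (hρ.ennreal_ofReal.mul hΦm)
    _ ≤ ∫⁻ (y : EuclideanSpace ℝ (ActiveIdx n k)),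
          ∫⁻ (z : EuclideanSpace ℝ (InactiveIdx n k)),
          ∫⁻ (z' : EuclideanSpace ℝ (InactiveIdx n k)), pairDiff ρ W k f' (y, (z, z')) := by
        refine lintegral_mono fun y => lintegral_mono fun z => ?_
        by_cases hy : y ∈ activeDomain ρ W k
        · have ha := hZ.marginalDensity_pos hN hρ0 hy
          have hfac : ENNReal.ofReal (ρ (combine W k y z)) =
              ENNReal.ofReal (marginalDensity ρ W k y) *
                ENNReal.ofReal (condDensity ρ W k y z) := by
            rw [← ENNReal.ofReal_mul ha.le, condDensity, mul_div_cancel₀ _ ha.ne']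
          have hHy : ∀ ω, H (ω, combine W k y z) = ENNReal.ofReal
              ((f' (combine W k y z) - monteCarlo f' W k N Z y ω) ^ 2) := fun ω => by
            simp only [hH, ridgeMonteCarlo, monteCarlo, activeVar_combine hW,
              extendSample_of_mem hy]
          simp only [hHy]
          calc _ ≤ _ := mul_le_mul' le_rfl (hZ.lintegral_sq_sub_le hN hy hρ hf' _)
            _ = _ := by
              rw [← lintegral_const_mul' _ _ ENNReal.ofReal_ne_top]
              refine lintegral_congr fun z' => ?_
              simp only [pairDiff, pairDensity, hfac]
              ring
        · have h0 : ρ (combine W k y z) = 0 := by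
            by_contra hne
            exact hy ⟨combine W k y z, lt_of_le_of_ne (hρ0 _) (Ne.symm hne),
              activeVar_combine hW y z⟩
          simp [h0]
    _ = ∫⁻ q, pairDiff ρ W k f' q := by
        have hm := measurable_pairDiff (W := W) (k := k) hρ hf'
        rw [Measure.volume_eq_prod, lintegral_prod _ hm.aemeasurable]
        refine lintegral_congr fun y => ?_
        rw [Measure.volume_eq_prod]
        exact (lintegral_prod _ (hm.comp measurable_prodMk_left).aemeasurable).symm

end MonteCarlo

/-! ### Conclusion -/

section Conclusion

variable {k : ℕ} {ρ f : EuclideanSpace ℝ (Fin n) → ℝ} {W : Matrix (Fin n) (Fin n) ℝ}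

lemma partialDeriv_indicator_domain (ho : IsOpen (domain ρ)) {x : EuclideanSpace ℝ (Fin n)}
    (hx : x ∈ domain ρ) (i : Fin n) :
    partialDeriv ((domain ρ).indicator f) i x = partialDeriv f i x :=
  ((Set.eqOn_indicator (s := domain ρ)).eventuallyEq_of_mem (ho.mem_nhds hx)).lineDeriv_eq

lemma HasSquareIntegrablePartials.measurable_indicator (hf : HasSquareIntegrablePartials ρ f)
    (hU : MeasurableSet (domain ρ)) : Measurable ((domain ρ).indicator f) := by
  refine measurable_of_restrict_of_restrict_compl hU ?_ ?_
  · convert hf.measurable using 1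
    ext x
    exact Set.indicator_of_mem x.2 f
  · convert measurable_const (a := (0 : ℝ)) using 1
    ext x
    exact Set.indicator_of_notMem x.2 f

lemma HasSquareIntegrablePartials.lintegral_partialDeriv_ne_top (hρ : Measurable ρ)
    (hρ0 : ∀ x, 0 ≤ ρ x) (hf : HasSquareIntegrablePartials ρ f) (i : Fin n) :
    ∫⁻ x, ‖(domain ρ).indicator (partialDeriv f i) x‖ₑ ^ 2 * ENNReal.ofReal (ρ x) ≠ ∞ := by
  have h := (lintegral_directional_sq hρ hρ0 hf (Pi.single i 1)).1
  have h2 : ∀ x, ∑ j, (Pi.single i 1 : Fin n → ℝ) j * (domain ρ).indicator (partialDeriv f j) x =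
      (domain ρ).indicator (partialDeriv f i) x := fun x => by
    simp [Pi.single_apply]
  simp only [h2] at h
  rw [h]
  exact ENNReal.ofReal_ne_top

/-- The conditional Poincaré inequality. -/
theorem IsUniformOrNormal.exists_lintegral_pairDiff_le (hρ : IsUniformOrNormal ρ) :
    ∃ C : ℝ, 0 < C ∧ ∀ f, HasSquareIntegrablePartials ρ f →
      ∀ W ∈ Matrix.orthogonalGroup (Fin n) ℝ, ∀ k < n,
        ∫⁻ q, pairDiff ρ W k ((domain ρ).indicator f) q ≤
          ENNReal.ofReal C * inactiveEnergy ρ W k f := by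
  obtain ⟨hm, h0, ho, A, B, δ, hAB, K, hK, hS⟩ := hρ.exists_isExhaustion
  -- The `2` is the loss from mollification, the sum makes the constant uniform in `k`, and `+ 1`
  -- ensures positivity.
  refine ⟨2 * ∑ k ∈ Finset.range n, (K k).toReal + 1, by positivity, fun f hf W hW k hk => ?_⟩
  have hU := ho.measurableSet
  have hind : ∀ i, (domain ρ).indicator (partialDeriv ((domain ρ).indicator f) i) =
      (domain ρ).indicator (partialDeriv f i) := fun i =>
    Set.indicator_congr fun x hx => partialDeriv_indicator_domain ho hx i
  have hd : ∀ x ∈ domain ρ, ∀ i, LineDifferentiableAt ℝ ((domain ρ).indicator f) x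
      (EuclideanSpace.single i (1 : ℝ)) := fun x hx i =>
    (hf.differentiable x hx i).congr_of_eventuallyEq
      ((Set.eqOn_indicator (s := domain ρ)).eventuallyEq_of_mem (ho.mem_nhds hx))
  have h := lintegral_pairDiff_le hm h0 hW hAB (hK k) (fun m => hS W hW k m)
    (hf.measurable_indicator hU) hd fun i => by
      rw [hind]
      exact hf.lintegral_partialDeriv_ne_top hm h0 i
  have hE : inactiveEnergy ρ W k ((domain ρ).indicator f) = inactiveEnergy ρ W k f := by
    simp only [inactiveEnergy, hind]
  rw [hE, ← mul_assoc, mul_comm (K k)] at h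
  refine h.trans (mul_le_mul_left ?_ _)
  rw [show (2 : ℝ≥0∞) = ENNReal.ofReal 2 by simp, ← ENNReal.ofReal_toReal (hK k),
    ← ENNReal.ofReal_mul (by norm_num)]
  refine ENNReal.ofReal_le_ofReal ?_
  have := Finset.single_le_sum (f := fun k => (K k).toReal) (fun _ _ => ENNReal.toReal_nonneg)
    (Finset.mem_range.2 hk)
  linarith

end Conclusion

end ActiveSubspace

end

theorem mainTheorem3 {n : ℕ} (ρ : EuclideanSpace ℝ (Fin n) → ℝ)
    (hρ : ActiveSubspace.IsUniformOrNormal ρ) :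
    ∃ C : ℝ, 0 < C ∧
      ∀ (f : EuclideanSpace ℝ (Fin n) → ℝ), ActiveSubspace.HasSquareIntegrablePartials ρ f →
      ∀ (W : Matrix (Fin n) (Fin n) ℝ) (lam : Fin n → ℝ),
        ActiveSubspace.IsEigendecomposition (ActiveSubspace.gradientMatrix ρ f) W lam →
      ∀ k : ℕ, 1 ≤ k → k < n →
      ∀ ε : ℝ, 0 < ε →
      ∀ What : Matrix (Fin n) (Fin n) ℝ, What ∈ Matrix.orthogonalGroup (Fin n) ℝ →
        ‖Matrix.toEuclideanCLM (n := Fin n) (𝕜 := ℝ) (W - What)‖ ≤ ε →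
      ∀ N : ℕ, 0 < N →
      ∀ (Ω : Type*) [MeasurableSpace Ω] (P : Measure Ω) [IsProbabilityMeasure P]
        (Z : Fin N → EuclideanSpace ℝ (ActiveSubspace.ActiveIdx n k) → Ω →
          EuclideanSpace ℝ (ActiveSubspace.InactiveIdx n k)),
        ActiveSubspace.IsMonteCarloSample P ρ What k N Z →
      ∫⁻ ω, ∫⁻ x, ENNReal.ofReal
          ((f x - ActiveSubspace.ridgeMonteCarlo f What k N Z x ω) ^ 2)
          ∂(ActiveSubspace.law ρ) ∂P
        ≤ ENNReal.ofReal (C * (1 + (N : ℝ) ^ (-(1 / 2) : ℝ)) ^ 2 *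
            (ε * √(∑ i : ActiveSubspace.ActiveIdx n k, lam i) +
              √(∑ i : ActiveSubspace.InactiveIdx n k, lam i)) ^ 2) := by
  obtain ⟨C, hC, hpoincare⟩ := hρ.exists_lintegral_pairDiff_le
  obtain ⟨hm, h0, ho, -⟩ := hρ.exists_isExhaustion
  refine ⟨C, hC, fun f hf W lam hW k _ hk ε hε What hWhat hdist N hN Ω _ P _ Z hZ => ?_⟩
  have hlam := ActiveSubspace.eigenvalue_nonneg hm h0 hf hW
  have hact : 0 ≤ ∑ i : ActiveSubspace.ActiveIdx n k, lam i := Finset.sum_nonneg fun i _ => hlam i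
  have hina : 0 ≤ ∑ i : ActiveSubspace.InactiveIdx n k, lam i :=
    Finset.sum_nonneg fun i _ => hlam i
  calc _ ≤ _ := hZ.lintegral_error_le hN hWhat hm h0 ho (hf.measurable_indicator ho.measurableSet)
        fun x hx => (Set.indicator_of_mem hx f).symm
    _ ≤ _ := hpoincare f hf What hWhat k hk
    _ ≤ _ := mul_le_mul' le_rfl (ActiveSubspace.inactiveEnergy_le hm h0 hf hW hWhat hdist)
    _ ≤ _ := by
      rw [← ENNReal.ofReal_mul hC.le]
      refine ENNReal.ofReal_le_ofReal ?_
      have hN1 : 1 ≤ (1 + (N : ℝ) ^ (-(1 / 2) : ℝ)) ^ 2 :=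
        one_le_pow₀ (le_add_of_nonneg_right (by positivity))
      refine mul_le_mul (le_mul_of_one_le_right hC.le hN1) ?_ (by positivity) (by positivity)
      -- The energy bound is `a² + b²` for the two summands `a`, `b` in the claim; the cross term
      -- `2ab` is nonnegative.
      have hcross : 0 ≤ ε * √(∑ i : ActiveSubspace.ActiveIdx n k, lam i) *
        √(∑ i : ActiveSubspace.InactiveIdx n k, lam i) := by positivity
      rw [add_sq, mul_pow, Real.sq_sqrt hact, Real.sq_sqrt hina]
      linarith
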